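/- Let $f:\mathbb{R}^n\to\mathbb{R}$ be $\mathcal{C}^2$ in a neighborhood of a nondegenerate critical point $\bar x$ of Morse index $1$ (that is, $\nabla f(\bar x)=0$, the Hessian at $\bar x$ is invertible, and the largest dimension of a subspace on which it is negative definite is $1$). For $\theta>0$ let $U=\{w:|w-\bar x|<\theta\}$, and call $(x_0,y_0)\in U\times U$ a starting pair if $f(x_0)=f(y_0)<f(\bar x)$ and $x_0,y_0$ lie in different path components of $\{w\in U: f(w)\le f(x_0)\}$. From a starting pair, the fast local level set algorithm proceeds for $i=0,1,2,\dots$ as follows, as long as $x_i\ne y_i$: 1. (a) Choose $\tilde x_i$ and $\tilde y_i$ at minimal distance from each other, with $\tilde x_i$ in the path component of $x_i$ and $\tilde y_i$ in the path component of $y_i$ in $\{w\in U: f(w)\le f(x_i)\}$, and replace $(x_i,y_i)$ by $(\tilde x_i,\tilde y_i)$. (b) Let $z_i$ be a minimizer of $f$ on $L_i\cap U$, where $L_i$ is the affine space through $\frac12(\tilde x_i+\tilde y_i)$ orthogonal to $\tilde x_i-\tilde y_i$. 2. Let $x_{i+1}$ be the point of $[\tilde x_i,z_i]$ furthest from $\tilde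 x_i$ such that $f\le f(z_i)$ on $[\tilde x_i,x_{i+1}]$, and let $y_{i+1}$ be defined in the same way from $\tilde y_i$ and $z_i$. If $x_i=y_i$ the algorithm stops, and all sequences are continued as constants ($\tilde x_j=\tilde y_j=z_j=x_j=y_j=x_i$ for $j\ge i$). Then there is $\theta_0>0$ such that for every $\theta\in(0,\theta_0]$ the following holds. For every starting pair and all sequences generated from it by the algorithm, the maxima (taken over the pair after the replacement in step 1(a)) $$M_i:=\max_{[\tilde x_i,\tilde y_i]}f$$ exist, satisfy $M_i\ge f(\bar x)$ for all $i$, and converge R-superlinearly to the critical value $f(\bar x)$: there is a real sequence $(t_i)$ with $t_i\to0$, $t_{i+1}=o(t_i)$ and $|M_i-f(\bar x)|\le t_i$ for all $i$. Moreover, there is $\varepsilon_0>0$ (depending on $\theta$) such that from every starting pair with $f(x_0)>f(\bar x)-\varepsilon_0$ the algorithm can indeed be carried out, i.e. it generates such sequences. -/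

import Mathlib

open Filter Topology Asymptotics

namespace MountainPass

/-- `ℝⁿ` with the Euclidean norm. -/
abbrev E (n : ℕ) : Type := EuclideanSpace ℝ (Fin n)

/-- The Hessian of `f` at `x`, as a bilinear form written in the curried way. -/
noncomputable def hessian {n : ℕ} (f : E n → ℝ) (x : E n) : E n →L[ℝ] E n →L[ℝ] ℝ :=
  fderiv ℝ (fderiv ℝ f) x

/-- `k` is the Morse index of `f` at `x`: the maximum dimension of a subspace on which the
Hessian is negative definite. -/
def HasMorseIndex {n : ℕ} (f : E n → ℝ) (x : E n) (k : ℕ) : Prop :=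
  IsGreatest {d : ℕ | ∃ S : Submodule ℝ (E n), Module.finrank ℝ S = d ∧
    ∀ v ∈ S, v ≠ 0 → hessian f x v v < 0} k

/-- `x` is a nondegenerate critical point of `f` of Morse index one. -/
structure IsNondegenerateCriticalPointOfIndexOne {n : ℕ} (f : E n → ℝ) (x : E n) : Prop where
  critical : fderiv ℝ f x = 0
  nondegenerate : (hessian f x).IsInvertible
  index : HasMorseIndex f x 1

/-- The path component of `x` in `{w ∈ U | f w ≤ l}`. -/
def levelComponent {n : ℕ} (f : E n → ℝ) (U : Set (E n)) (l : ℝ) (x : E n) : Set (E n) :=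
  pathComponentIn ({w | f w ≤ l} ∩ U) x

/-- `(p, q)` is a closest pair of the components of `x` and of `y` in `{w ∈ U | f w ≤ f x}`. -/
structure IsClosestPair {n : ℕ} (f : E n → ℝ) (U : Set (E n)) (x y p q : E n) : Prop where
  left_mem : p ∈ levelComponent f U (f x) x
  right_mem : q ∈ levelComponent f U (f x) y
  dist_le : ∀ p' ∈ levelComponent f U (f x) x, ∀ q' ∈ levelComponent f U (f x) y,
    dist p q ≤ dist p' q'

/-- `z` minimizes `f` over the part in `U` of the affine space through the midpoint of `p` and
`q` that is orthogonal to `p - q`. -/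
structure IsBisectorMinimizer {n : ℕ} (f : E n → ℝ) (U : Set (E n)) (p q z : E n) : Prop where
  mem_bisector : z ∈ AffineSubspace.perpBisector p q
  mem : z ∈ U
  le : ∀ w ∈ AffineSubspace.perpBisector p q, w ∈ U → f z ≤ f w

/-- `p'` is the point of `[p, z]` furthest from `p` such that `f ≤ f z` on `[p, p']`. -/
structure IsFurthestPoint {n : ℕ} (f : E n → ℝ) (p z p' : E n) : Prop where
  mem : p' ∈ segment ℝ p z
  le : ∀ w ∈ segment ℝ p p', f w ≤ f z
  furthest : ∀ r ∈ segment ℝ p z, (∀ w ∈ segment ℝ p r, f w ≤ f z) → dist p r ≤ dist p p'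

/-- One pass of the algorithm from `(x, y)`: the pair is replaced by the closest pair `(p, q)`,
then `z` and the next pair `(x', y')` are computed from `(p, q)`. -/
structure IsStep {n : ℕ} (f : E n → ℝ) (U : Set (E n)) (x y p q z x' y' : E n) : Prop where
  closest : IsClosestPair f U x y p q
  minimizer : IsBisectorMinimizer f U p q z
  next_left : IsFurthestPoint f p z x'
  next_right : IsFurthestPoint f q z y'

/-- The sequences are generated by the algorithm from `x₀, y₀`; here `(x i, y i)` is the pair
with which pass `i` starts and `(p i, q i)` the closest pair that replaces it. The algorithm stops
when the two points coincide; all sequences are then continued as constants. -/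
structure IsRun {n : ℕ} (f : E n → ℝ) (U : Set (E n)) (x₀ y₀ : E n)
    (x y p q z : ℕ → E n) : Prop where
  init_left : x 0 = x₀
  init_right : y 0 = y₀
  step : ∀ i, x i ≠ y i → IsStep f U (x i) (y i) (p i) (q i) (z i) (x (i + 1)) (y (i + 1))
  terminated : ∀ i, x i = y i →
    p i = x i ∧ q i = x i ∧ z i = x i ∧ x (i + 1) = x i ∧ y (i + 1) = x i

/-- Conditions (a) and (b) on the starting points: they lie in different path components of
`{w ∈ U | f w ≤ f x₀}`, and their common value is below the critical value `c`. -/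
structure IsStartingPair {n : ℕ} (f : E n → ℝ) (U : Set (E n)) (c : ℝ) (x₀ y₀ : E n) : Prop where
  left_mem : x₀ ∈ U
  right_mem : y₀ ∈ U
  value_eq : f x₀ = f y₀
  value_lt : f x₀ < c
  not_joined : ¬ JoinedIn ({w | f w ≤ f x₀} ∩ U) x₀ y₀

/-- Superlinear convergence to zero, `t (i + 1) / t i → 0`, stated so that the sequence may
reach its limit after finitely many terms. -/
def SuperlinearToZero (t : ℕ → ℝ) : Prop :=
  Tendsto t atTop (𝓝 0) ∧ (fun i => t (i + 1)) =o[atTop] t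

/-- R-superlinear convergence to zero. -/
def RSuperlinearToZero (s : ℕ → ℝ) : Prop :=
  ∃ t : ℕ → ℝ, SuperlinearToZero t ∧ ∀ i, |s i| ≤ t i

end MountainPass

/-! Write `X = w - xbar`. On a small ball, `∇ f` is `H X` and `f` is `f xbar + ⟪H X, X⟫ / 2` up to
relative errors `η`, and `η` is as small as desired on a small enough ball. Index one and
nondegeneracy give `H` a single negative eigendirection `e`, with eigenvalue `-a`, and make it
coercive on the orthogonal complement of `e`.

At a closest pair `p ≠ q` below the critical level, with `D = q - p`, the gradients at `p` and `q`
are `λ D` and `-μ D` with `λ, μ > 0` (`gradient_eq_of_closest`). In the quadratic model subtraction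
gives `H D = -(λ + μ) D`, so `D` is parallel to `e`, and equality of the two values makes `p` and
`q` opposite with respect to `xbar`. `exists_align` is the stable version: this holds up to `ε ‖D‖`,
for any `ε` if `η` is small. The bisector then passes close to `xbar` and is nearly orthogonal to
`e`, so `‖z - xbar‖ ≤ 2 ε ‖D‖` (`exists_norm_le_of_gradient_parallel`). Hence the next level `f z`
is at most `C (2 ε)² ‖D‖²` below the critical value, while the next closest pair, with difference
`D'`, is at least `c ‖D'‖²` below it. This gives `c ‖D'‖² ≤ C (2 ε)² ‖D‖²` (`contraction`), with `c`
and `C` independent of `ε`. One small `ε` yields geometric decay; the pairs then enter every smaller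
ball, where `ε` may be decreased, so the decay is superlinear.

The segment from `p` to `q` crosses the hyperplane through `xbar` orthogonal to `e`, on which `f ≥ f
xbar`. So its maximum lies between `f xbar` and `f xbar + C ‖D‖²`, and `t i = C ‖D i‖²` is the
required bound. The same hyperplane keeps the two points of the next pair in different components
(`step_outcome`).

For existence, the difficulty is that the ball is open. Near the critical level, path components of
sublevel sets are the two sides of the hyperplane (`mem_levelComponent_iff`), and all sublevel
points lie in a double cone around `e`. Pairs that leave the half ball are therefore no shorter than
a competitor on the axis, and bisector points outside the half ball have value at least `f xbar`, so
both minimizations reduce to compact sets. -/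

namespace MountainPass

open scoped RealInnerProductSpace Gradient

/-! ### Symmetric forms with one negative direction -/

section LinearAlgebra

variable {F : Type*} [NormedAddCommGroup F] [InnerProductSpace ℝ F]

/-- `H` is symmetric, `e` is a unit eigenvector of `H` with eigenvalue `-a`, and `H` is coercive
with constant `b ≤ a` on the orthogonal complement of `e`. -/
structure IsSaddleForm (H : F →L[ℝ] F) (e : F) (a b : ℝ) : Prop where
  norm_eq : ‖e‖ = 1
  pos : 0 < b
  le : b ≤ a
  symm : ∀ x y, ⟪H x, y⟫ = ⟪x, H y⟫
  map_eq : H e = -(a • e)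
  coercive : ∀ w, ⟪e, w⟫ = 0 → b * ‖w‖ ^ 2 ≤ ⟪H w, w⟫

/-- The component of `v` orthogonal to the unit vector `e`. -/
def perp (e v : F) : F := v - ⟪e, v⟫ • e

lemma perp_add (e v w : F) : perp e (v + w) = perp e v + perp e w := by
  simp only [perp, inner_add_right, add_smul]; abel

lemma perp_sub (e v w : F) : perp e (v - w) = perp e v - perp e w := by
  simp only [perp, inner_sub_right, sub_smul]; abel

lemma perp_smul (e v : F) (t : ℝ) : perp e (t • v) = t • perp e v := by
  simp only [perp, inner_smul_right, smul_sub, smul_smul]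

lemma eq_add_perp (e v : F) : v = ⟪e, v⟫ • e + perp e v := by
  simp [perp]

lemma inner_perp {e : F} (he : ‖e‖ = 1) (v : F) : ⟪e, perp e v⟫ = 0 := by
  simp [perp, inner_sub_right, inner_smul_right, he]

lemma norm_sq_eq {e : F} (he : ‖e‖ = 1) (v : F) :
    ‖v‖ ^ 2 = ⟪e, v⟫ ^ 2 + ‖perp e v‖ ^ 2 := by
  conv_lhs => rw [eq_add_perp e v]
  rw [norm_add_sq_real, inner_smul_left, inner_perp he, norm_smul, he]
  simp

lemma norm_perp_le {e : F} (he : ‖e‖ = 1) (v : F) : ‖perp e v‖ ≤ ‖v‖ := by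
  have := norm_sq_eq he v
  exact le_of_sq_le_sq (by nlinarith [sq_nonneg ⟪e, v⟫]) (norm_nonneg v)

lemma abs_inner_unit_le {e : F} (he : ‖e‖ = 1) (v : F) : |⟪e, v⟫| ≤ ‖v‖ := by
  simpa [he] using abs_real_inner_le_norm e v

lemma norm_le_abs_add_perp {e : F} (he : ‖e‖ = 1) (v : F) :
    ‖v‖ ≤ |⟪e, v⟫| + ‖perp e v‖ := by
  conv_lhs => rw [eq_add_perp e v]
  refine (norm_add_le _ _).trans ?_
  rw [norm_smul, he, mul_one, Real.norm_eq_abs]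

namespace IsSaddleForm

variable {H : F →L[ℝ] F} {e : F} {a b : ℝ}

lemma a_pos (h : IsSaddleForm H e a b) : 0 < a := h.pos.trans_le h.le

lemma inner_map (h : IsSaddleForm H e a b) (v : F) : ⟪e, H v⟫ = -a * ⟪e, v⟫ := by
  rw [← h.symm, h.map_eq, inner_neg_left, inner_smul_left]; simp

lemma perp_map (h : IsSaddleForm H e a b) (v : F) : perp e (H v) = H (perp e v) := by
  rw [perp, h.inner_map, perp, map_sub, map_smul, h.map_eq]
  module

lemma inner_map_self (h : IsSaddleForm H e a b) (v : F) :
    ⟪H v, v⟫ = -a * ⟪e, v⟫ ^ 2 + ⟪H (perp e v), perp e v⟫ := by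
  have h0 : ⟪H (perp e v), e⟫ = 0 := by
    rw [real_inner_comm, h.inner_map, inner_perp h.norm_eq, mul_zero]
  have h1 := inner_perp h.norm_eq v
  conv_lhs => rw [eq_add_perp e v]
  rw [map_add, map_smul, h.map_eq]
  simp only [inner_add_left, inner_add_right, inner_smul_left, inner_smul_right, inner_neg_left,
    h0, h1, real_inner_self_eq_norm_sq, h.norm_eq]
  simp
  ring

lemma coercive_perp (h : IsSaddleForm H e a b) (v : F) :
    b * ‖perp e v‖ ^ 2 ≤ ⟪H (perp e v), perp e v⟫ :=
  h.coercive _ (inner_perp h.norm_eq v)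

lemma le_norm_map_perp (h : IsSaddleForm H e a b) (v : F) :
    b * ‖perp e v‖ ≤ ‖perp e (H v)‖ := by
  rw [h.perp_map]
  rcases eq_or_lt_of_le (norm_nonneg (perp e v)) with h0 | h0
  · rw [← h0]; simp
  · have h1 := h.coercive_perp v
    have h2 := real_inner_le_norm (H (perp e v)) (perp e v)
    exact le_of_mul_le_mul_right (by nlinarith) h0

/-- `H` respects the splitting into the line of `e` and its complement; it scales the line by `a ≥
b` and expands the complement by at least `b`. -/
lemma le_norm_map (h : IsSaddleForm H e a b) (v : F) : b * ‖v‖ ≤ ‖H v‖ := by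
  have h1 := h.le_norm_map_perp v
  have h2 := norm_sq_eq h.norm_eq v
  have h3 := norm_sq_eq h.norm_eq (H v)
  rw [h.inner_map] at h3
  have hb := h.pos
  have h5 : (b * ‖perp e v‖) ^ 2 ≤ ‖perp e (H v)‖ ^ 2 := by gcongr
  have h6 : b ^ 2 ≤ a ^ 2 := by have := h.le; gcongr
  refine le_of_sq_le_sq ?_ (norm_nonneg _)
  nlinarith [mul_le_mul_of_nonneg_right h6 (sq_nonneg ⟪e, v⟫)]

lemma inner_map_perp_le (_ : IsSaddleForm H e a b) (v : F) :
    ⟪H (perp e v), perp e v⟫ ≤ ‖H‖ * ‖perp e v‖ ^ 2 := by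
  have h2 := real_inner_le_norm (H (perp e v)) (perp e v)
  have h3 := H.le_opNorm (perp e v)
  nlinarith [norm_nonneg (perp e v)]

lemma inner_map_le (h : IsSaddleForm H e a b) (v : F) :
    ⟪H v, v⟫ ≤ -a * ⟪e, v⟫ ^ 2 + ‖H‖ * ‖perp e v‖ ^ 2 := by
  rw [h.inner_map_self]; linarith [h.inner_map_perp_le v]

lemma le_inner_map (h : IsSaddleForm H e a b) (v : F) :
    -a * ⟪e, v⟫ ^ 2 + b * ‖perp e v‖ ^ 2 ≤ ⟪H v, v⟫ := by
  rw [h.inner_map_self]; linarith [h.coercive_perp v]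

/-- Since `η ≤ b / 2`, the error absorbs at most half of the lower bound `b * ‖X‖` for `‖H X‖`, so
the size of the gradient controls the distance to the critical point. -/
lemma norm_le_of_gradients (h : IsSaddleForm H e a b) {η lam mu : ℝ} {P Q : F}
    (hηb : η ≤ b / 2) (hlam : 0 < lam) (hmu : 0 < mu)
    (hG : ‖lam • (Q - P) - H P‖ ≤ η * ‖P‖) (hK : ‖-(mu • (Q - P)) - H Q‖ ≤ η * ‖Q‖) :
    ‖P‖ ≤ 2 / b * (lam * ‖Q - P‖) ∧ ‖Q‖ ≤ 2 / b * (mu * ‖Q - P‖) := by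
  have hb := h.pos
  have key : ∀ {c : ℝ} {X Y : F}, 0 < c → ‖Y - H X‖ ≤ η * ‖X‖ → ‖Y‖ = c * ‖Q - P‖ →
      ‖X‖ ≤ 2 / b * (c * ‖Q - P‖) := by
    intro c X Y hc h1 h2
    have h3 := h.le_norm_map X
    have h4 : ‖H X‖ ≤ ‖Y‖ + ‖Y - H X‖ := by
      simpa using norm_sub_le Y (Y - H X)
    rw [div_mul_eq_mul_div, le_div_iff₀ hb]
    nlinarith [norm_nonneg X]
  refine ⟨key hlam hG ?_, key hmu hK ?_⟩
  · rw [norm_smul, Real.norm_of_nonneg hlam.le]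
  · rw [norm_neg, norm_smul, Real.norm_of_nonneg hmu.le]

end IsSaddleForm

end LinearAlgebra

/-! ### Alignment of closest pairs with the negative direction -/

section Alignment

variable {F : Type*} [NormedAddCommGroup F] [InnerProductSpace ℝ F]

namespace IsSaddleForm

variable {H : F →L[ℝ] F} {e : F} {a b : ℝ}

/-- If the approximate gradients at `P` and `Q` are opposite multiples of `Q - P`, then `Q - P` is
nearly parallel to `e`, and the sum of the multiples is nearly `a`. -/
lemma perp_sub_le_and_abs_sub_le (h : IsSaddleForm H e a b) {η lam mu : ℝ} {P Q : F}
    (hη : 0 ≤ η) (hηb : η ≤ b / 2) (hlam : 0 < lam) (hmu : 0 < mu)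
    (hG : ‖lam • (Q - P) - H P‖ ≤ η * ‖P‖) (hK : ‖-(mu • (Q - P)) - H Q‖ ≤ η * ‖Q‖) :
    b * ‖perp e (Q - P)‖ ≤ 2 * η * ‖Q - P‖ ∧
      b * (|lam + mu - a| * |⟪e, Q - P⟫|) ≤ 2 * η * ((lam + mu) * ‖Q - P‖) := by
  have hb := h.pos
  obtain ⟨hP, hQ⟩ := h.norm_le_of_gradients hηb hlam hmu hG hK
  set D := Q - P with hD
  -- `R` measures how far `D` is from being an eigenvector for `-(lam + mu)`; it is the difference
  -- of the two gradient errors. Its bound carries the factor `lam + mu`, which cancels in the first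
  -- estimate, so no prior bound on the multipliers is needed.
  set R := H D + (lam + mu) • D with hR
  have hR' : R = (lam • D - H P) - (-(mu • D) - H Q) := by
    rw [hR, hD, map_sub]; module
  have hRn : b * ‖R‖ ≤ 2 * η * ((lam + mu) * ‖D‖) := by
    have h1 : ‖R‖ ≤ η * ‖P‖ + η * ‖Q‖ := by
      rw [hR']; exact (norm_sub_le _ _).trans (add_le_add hG hK)
    have h2 : ‖P‖ + ‖Q‖ ≤ 2 / b * ((lam + mu) * ‖D‖) := by linarith
    calc b * ‖R‖ ≤ b * (η * (‖P‖ + ‖Q‖)) := by gcongr; linarith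
      _ ≤ b * (η * (2 / b * ((lam + mu) * ‖D‖))) := by gcongr
      _ = _ := by field_simp
  have hs : 0 < lam + mu := by positivity
  constructor
  · have h1 : perp e R = H (perp e D) + (lam + mu) • perp e D := by
      rw [hR, perp_add, perp_smul, h.perp_map]
    have h2 : ⟪perp e R, perp e D⟫ ≤ ‖R‖ * ‖perp e D‖ :=
      (real_inner_le_norm _ _).trans (by gcongr; exact norm_perp_le h.norm_eq R)
    have h3 : (lam + mu) * ‖perp e D‖ ^ 2 ≤ ⟪perp e R, perp e D⟫ := by
      rw [h1, inner_add_left, inner_smul_left, real_inner_self_eq_norm_sq]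
      have := h.coercive_perp D
      have : 0 ≤ b * ‖perp e D‖ ^ 2 := by positivity
      simp; linarith
    rcases eq_or_lt_of_le (norm_nonneg (perp e D)) with h0 | h0
    · rw [← h0]; simp; positivity
    · have h4 : (lam + mu) * ‖perp e D‖ ≤ ‖R‖ := le_of_mul_le_mul_right (by nlinarith) h0
      have h5 : (lam + mu) * (b * ‖perp e D‖) ≤ (lam + mu) * (2 * η * ‖D‖) := by nlinarith
      exact le_of_mul_le_mul_left h5 hs
  · have h1 : ⟪e, R⟫ = (lam + mu - a) * ⟪e, D⟫ := by
      rw [hR, inner_add_right, h.inner_map, inner_smul_right]; ring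
    rw [← abs_mul, ← h1]
    have := abs_inner_unit_le h.norm_eq R
    exact (by gcongr : b * |⟪e, R⟫| ≤ b * ‖R‖).trans hRn

/-- For `η ≤ b / 16` the orthogonal part of `Q - P` is at most an eighth of its norm, so the
`e`-component dominates. Dividing the second alignment estimate by it leaves `|lam + mu - a| ≤ (lam
+ mu) / 4`. -/
lemma add_le_of_gradients (h : IsSaddleForm H e a b) {η lam mu : ℝ} {P Q : F} (hPQ : Q - P ≠ 0)
    (hη : 0 ≤ η) (hηb : η ≤ b / 16) (hlam : 0 < lam) (hmu : 0 < mu)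
    (hG : ‖lam • (Q - P) - H P‖ ≤ η * ‖P‖) (hK : ‖-(mu • (Q - P)) - H Q‖ ≤ η * ‖Q‖) :
    ‖Q - P‖ / 2 ≤ |⟪e, Q - P⟫| ∧ lam + mu ≤ 2 * a := by
  have hb := h.pos
  obtain ⟨h1, h2⟩ := h.perp_sub_le_and_abs_sub_le hη (by linarith) hlam hmu hG hK
  have hN : 0 < ‖Q - P‖ := norm_pos_iff.mpr hPQ
  have h3 : ‖perp e (Q - P)‖ ≤ ‖Q - P‖ / 8 := by
    refine le_of_mul_le_mul_left (h1.trans ?_) hb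
    nlinarith
  have h4 := norm_le_abs_add_perp h.norm_eq (Q - P)
  have h5 : ‖Q - P‖ / 2 ≤ |⟪e, Q - P⟫| := by linarith
  refine ⟨h5, ?_⟩
  have h6 : |lam + mu - a| * (‖Q - P‖ / 2) ≤ |lam + mu - a| * |⟪e, Q - P⟫| := by gcongr
  have h7 : b * (|lam + mu - a| * (‖Q - P‖ / 2)) ≤ b * ((lam + mu) / 4 * (‖Q - P‖ / 2)) := by
    refine (mul_le_mul_of_nonneg_left h6 hb.le).trans (h2.trans ?_)
    have : 0 ≤ (lam + mu) * ‖Q - P‖ := by positivity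
    nlinarith
  have h8 := le_of_mul_le_mul_right (le_of_mul_le_mul_left h7 hb) (by positivity)
  have := le_abs_self (lam + mu - a)
  linarith

/-- The orthogonal part of `H P` is that of `lam • D` up to the gradient error, both of order `η *
N`, and `H` is bounded below there. The sign of `lam` is left free so that the bound also serves the
other point, with `-mu`. -/
lemma norm_perp_le_of_gradient (h : IsSaddleForm H e a b) {η lam N : ℝ} {P D : F}
    (hη : 0 ≤ η) (hlam : |lam| ≤ 2 * a)
    (hG : ‖lam • D - H P‖ ≤ η * ‖P‖) (hD : b * ‖perp e D‖ ≤ 2 * η * N)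
    (hP : ‖P‖ ≤ 4 * a / b * N) : ‖perp e P‖ ≤ 8 * a / b ^ 2 * η * N := by
  have hb := h.pos
  have ha := h.a_pos
  have h1 := h.le_norm_map_perp P
  have h2 : perp e (H P) = lam • perp e D - perp e (lam • D - H P) := by
    rw [perp_sub, perp_smul]; abel
  have h3 : ‖perp e (H P)‖ ≤ |lam| * ‖perp e D‖ + η * ‖P‖ := by
    rw [h2]
    refine (norm_sub_le _ _).trans (add_le_add ?_ ((norm_perp_le h.norm_eq _).trans hG))
    rw [norm_smul, Real.norm_eq_abs]
  have h4 : ‖perp e D‖ ≤ 2 * η * N / b := by rw [le_div_iff₀ hb]; linarith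
  have h5 : b * ‖perp e P‖ ≤ 2 * a * (2 * η * N / b) + η * (4 * a / b * N) := by
    refine h1.trans (h3.trans ?_)
    gcongr
  refine le_of_mul_le_mul_left (h5.trans_eq ?_) hb
  field_simp
  ring

/-- If the approximate gradients at two points of equal value are opposite multiples of `Q - P`,
then `P` and `Q` are nearly opposite points on the line spanned by `e`. -/
theorem exists_align (h : IsSaddleForm H e a b) {ε : ℝ} (hε : 0 < ε) :
    ∃ η₁ : ℝ, 0 < η₁ ∧ ∀ {η lam mu α : ℝ} {P Q : F}, Q - P ≠ 0 → 0 ≤ η → η ≤ η₁ →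
      0 < lam → 0 < mu →
      ‖lam • (Q - P) - H P‖ ≤ η * ‖P‖ → ‖-(mu • (Q - P)) - H Q‖ ≤ η * ‖Q‖ →
      |α - 1 / 2 * ⟪H P, P⟫| ≤ η * ‖P‖ ^ 2 → |α - 1 / 2 * ⟪H Q, Q⟫| ≤ η * ‖Q‖ ^ 2 →
      ‖P + Q‖ ≤ ε * ‖Q - P‖ ∧ ‖perp e (Q - P)‖ ≤ ε * ‖Q - P‖ := by
  have hb := h.pos
  have ha := h.a_pos
  set C₁ : ℝ := 8 * a / b ^ 2 with hC₁
  have hC₁p : 0 < C₁ := by positivity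
  -- `C₂` bounds the discrepancy of the squared `e`-components: the first term comes from the
  -- orthogonal parts of the form, the second from the errors in the two values. The three terms of
  -- `C` below bound the `e`-component of `P + Q`, its orthogonal part, and the orthogonal part of
  -- `Q - P`.
  set C₂ : ℝ := 2 * ‖H‖ * C₁ ^ 2 + 4 * (4 * a / b) ^ 2 with hC₂
  have hC₂p : 0 < C₂ := by positivity
  set C : ℝ := 2 * C₂ / a + 2 * C₁ + 2 / b with hC
  have hCp : 0 < C := by positivity
  refine ⟨min (min (b / 16) 1) (ε / C), by positivity, ?_⟩
  intro η lam mu α P Q hPQ hη hη1 hlam hmu hG hK hα hβ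
  have hηb : η ≤ b / 16 := hη1.trans ((min_le_left _ _).trans (min_le_left _ _))
  have hη1' : η ≤ 1 := hη1.trans ((min_le_left _ _).trans (min_le_right _ _))
  have hηC : C * η ≤ ε := by
    have : η ≤ ε / C := hη1.trans (min_le_right _ _)
    rw [le_div_iff₀ hCp] at this; linarith
  obtain ⟨hD1, -⟩ := h.perp_sub_le_and_abs_sub_le hη (by linarith) hlam hmu hG hK
  obtain ⟨hDu, hs⟩ := h.add_le_of_gradients hPQ hη hηb hlam hmu hG hK
  obtain ⟨hP, hQ⟩ := h.norm_le_of_gradients (by linarith) hlam hmu hG hK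
  have hN : 0 < ‖Q - P‖ := norm_pos_iff.mpr hPQ
  set D := Q - P with hD
  set N := ‖D‖ with hNdef
  have hP' : ‖P‖ ≤ 4 * a / b * N := by
    refine hP.trans ?_
    have : lam * N ≤ 2 * a * N := by gcongr; linarith
    calc 2 / b * (lam * N) ≤ 2 / b * (2 * a * N) := by gcongr
      _ = _ := by ring
  have hQ' : ‖Q‖ ≤ 4 * a / b * N := by
    refine hQ.trans ?_
    have : mu * N ≤ 2 * a * N := by gcongr; linarith
    calc 2 / b * (mu * N) ≤ 2 / b * (2 * a * N) := by gcongr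
      _ = _ := by ring
  have hPp : ‖perp e P‖ ≤ C₁ * η * N :=
    h.norm_perp_le_of_gradient hη (by rw [abs_of_pos hlam]; linarith) hG hD1 hP'
  have hQp : ‖perp e Q‖ ≤ C₁ * η * N :=
    h.norm_perp_le_of_gradient (lam := -mu) hη (by rw [abs_neg, abs_of_pos hmu]; linarith)
      (by rwa [neg_smul]) hD1 hQ'
  have hPu := h.inner_map_self P
  have hQu := h.inner_map_self Q
  have bound : ∀ X : F, ‖perp e X‖ ≤ C₁ * η * N →
      0 ≤ ⟪H (perp e X), perp e X⟫ ∧ ⟪H (perp e X), perp e X⟫ ≤ ‖H‖ * C₁ ^ 2 * (η * N ^ 2) := by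
    intro X hX
    refine ⟨le_trans (by positivity) (h.coercive_perp X), (h.inner_map_perp_le X).trans ?_⟩
    have h1 : ‖perp e X‖ ^ 2 ≤ (C₁ * η * N) ^ 2 := by gcongr
    have h2 : η ^ 2 ≤ η := by nlinarith
    have h3 : (C₁ * η * N) ^ 2 ≤ C₁ ^ 2 * (η * N ^ 2) := by
      calc (C₁ * η * N) ^ 2 = C₁ ^ 2 * (η ^ 2 * N ^ 2) := by ring
        _ ≤ _ := by gcongr
    calc ‖H‖ * ‖perp e X‖ ^ 2 ≤ ‖H‖ * (C₁ ^ 2 * (η * N ^ 2)) := by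
          gcongr; exact h1.trans h3
      _ = _ := by ring
  have hsq : ∀ X : F, ‖X‖ ≤ 4 * a / b * N → η * ‖X‖ ^ 2 ≤ (4 * a / b) ^ 2 * (η * N ^ 2) := by
    intro X hX
    have h1 : ‖X‖ ^ 2 ≤ (4 * a / b * N) ^ 2 := by gcongr
    calc η * ‖X‖ ^ 2 ≤ η * (4 * a / b * N) ^ 2 := by gcongr
      _ = _ := by ring
  obtain ⟨b1, b2⟩ := bound P hPp
  obtain ⟨b3, b4⟩ := bound Q hQp
  have s1 := hsq P hP'
  have s2 := hsq Q hQ'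
  rw [abs_le] at hα hβ
  have hdiff : a * |⟪e, P⟫ ^ 2 - ⟪e, Q⟫ ^ 2| ≤ C₂ * (η * N ^ 2) := by
    have h1 : C₂ * (η * N ^ 2) =
        2 * (‖H‖ * C₁ ^ 2 * (η * N ^ 2)) + 4 * ((4 * a / b) ^ 2 * (η * N ^ 2)) := by
      rw [hC₂]; ring
    have h2 : a * |⟪e, P⟫ ^ 2 - ⟪e, Q⟫ ^ 2| = |a * (⟪e, P⟫ ^ 2 - ⟪e, Q⟫ ^ 2)| := by
      rw [abs_mul, abs_of_pos ha]
    rw [h1, h2, abs_le]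
    constructor <;> linarith
  -- The difference of squares factors through `⟪e, P + Q⟫` and `⟪e, D⟫`; the second factor is at
  -- least `N / 2` in absolute value and can be divided out.
  have hsum : |⟪e, P + Q⟫| ≤ 2 * C₂ / a * η * N := by
    have h1 : |⟪e, P⟫ ^ 2 - ⟪e, Q⟫ ^ 2| = |⟪e, P + Q⟫| * |⟪e, D⟫| := by
      rw [← abs_mul, ← abs_neg, hD, inner_add_right, inner_sub_right]; congr 1; ring
    have h2 : a * (|⟪e, P + Q⟫| * (N / 2)) ≤ C₂ * (η * N ^ 2) := by
      refine le_trans ?_ hdiff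
      rw [h1]
      gcongr
    refine le_of_mul_le_mul_right ?_ (by positivity : 0 < a * (N / 2))
    calc |⟪e, P + Q⟫| * (a * (N / 2)) = a * (|⟪e, P + Q⟫| * (N / 2)) := by ring
      _ ≤ _ := h2
      _ = _ := by field_simp
  have hbN : ‖perp e D‖ ≤ 2 / b * η * N := by
    refine le_of_mul_le_mul_left (hD1.trans_eq ?_) hb
    field_simp
  have hηN : 0 ≤ η * N := by positivity
  have hεN : C * η * N ≤ ε * N := by gcongr
  have t1 : 0 ≤ 2 * C₂ / a * η * N := by positivity
  have t2 : 0 ≤ C₁ * η * N := by positivity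
  have t3 : 0 ≤ 2 / b * η * N := by positivity
  have hsplit : C * η * N = 2 * C₂ / a * η * N + 2 * (C₁ * η * N) + 2 / b * η * N := by
    rw [hC]; ring
  constructor
  · have h1 := norm_le_abs_add_perp h.norm_eq (P + Q)
    have h2 : ‖perp e (P + Q)‖ ≤ ‖perp e P‖ + ‖perp e Q‖ := by
      rw [perp_add]; exact norm_add_le _ _
    linarith
  · linarith

/-- A point near the bisector of an aligned pair whose approximate gradient is parallel to the
difference `D` of the pair is small compared to `D`. -/
theorem exists_norm_le_of_gradient_parallel (h : IsSaddleForm H e a b) :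
    ∃ ε₁ : ℝ, 0 < ε₁ ∧ ∃ η₁ : ℝ, 0 < η₁ ∧ ∀ {η δ κ : ℝ} {D Z : F}, D ≠ 0 → 0 ≤ η → η ≤ η₁ →
      ‖perp e D‖ ≤ ε₁ * ‖D‖ → ‖κ • D - H Z‖ ≤ η * ‖Z‖ → |⟪Z, D⟫| ≤ δ * ‖D‖ ^ 2 →
      ‖Z‖ ≤ 4 * δ * ‖D‖ := by
  have hb := h.pos
  have ha := h.a_pos
  refine ⟨min (1 / 16) (b / (16 * (2 * (a + 1)))), by positivity, min (b / 16) 1, by positivity, ?_⟩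
  intro η δ κ D Z hD0 hη hη1 hD hG hin
  have hN : 0 < ‖D‖ := norm_pos_iff.mpr hD0
  set N := ‖D‖ with hNdef
  set ε := min (1 / 16) (b / (16 * (2 * (a + 1)))) with hεdef
  have hε0 : 0 < ε := by positivity
  have hε1 : ε ≤ 1 / 16 := min_le_left _ _
  have hε2 : 2 * (a + 1) * ε ≤ b / 16 := by
    have : ε ≤ b / (16 * (2 * (a + 1))) := min_le_right _ _
    rw [le_div_iff₀ (by positivity)] at this; linarith
  have hηb : η ≤ b / 16 := hη1.trans (min_le_left _ _)
  have hη1' : η ≤ 1 := hη1.trans (min_le_right _ _)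
  have hDu : N / 2 ≤ |⟪e, D⟫| := by
    have := norm_le_abs_add_perp h.norm_eq D
    nlinarith
  have hu : ⟪Z, D⟫ = ⟪e, Z⟫ * ⟪e, D⟫ + ⟪perp e Z, perp e D⟫ := by
    conv_lhs => rw [eq_add_perp e Z, eq_add_perp e D]
    simp only [inner_add_left, inner_add_right, inner_smul_left, inner_smul_right,
      inner_perp h.norm_eq, real_inner_comm e, real_inner_self_eq_norm_sq, h.norm_eq]
    simp; ring
  have hZu : |⟪e, Z⟫| ≤ 2 * δ * N + 2 * ε * ‖Z‖ := by
    have h1 : |⟪perp e Z, perp e D⟫| ≤ ‖Z‖ * (ε * N) :=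
      (abs_real_inner_le_norm _ _).trans (mul_le_mul (norm_perp_le h.norm_eq Z) hD
        (norm_nonneg _) (norm_nonneg _))
    have h2 : |⟪e, Z⟫| * |⟪e, D⟫| ≤ δ * N ^ 2 + ‖Z‖ * (ε * N) := by
      rw [← abs_mul, show ⟪e, Z⟫ * ⟪e, D⟫ = ⟪Z, D⟫ - ⟪perp e Z, perp e D⟫ by rw [hu]; ring]
      exact (abs_sub _ _).trans (add_le_add hin h1)
    have h3 : |⟪e, Z⟫| * (N / 2) ≤ |⟪e, Z⟫| * |⟪e, D⟫| := by gcongr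
    refine le_of_mul_le_mul_right ?_ (by positivity : 0 < N / 2)
    nlinarith
  -- Nothing is assumed about `κ`; the `e`-component of the gradient relation bounds it. This makes
  -- `κ • perp e D` negligible, since `perp e D` is.
  have hκ : |κ| * (N / 2) ≤ (a + 1) * ‖Z‖ := by
    have h1 := abs_inner_unit_le h.norm_eq (κ • D - H Z)
    rw [inner_sub_right, inner_smul_right, h.inner_map] at h1
    have h2 : |κ * ⟪e, D⟫| ≤ η * ‖Z‖ + a * ‖Z‖ := by
      have h3 : |a * ⟪e, Z⟫| ≤ a * ‖Z‖ := by
        rw [abs_mul, abs_of_pos ha]; gcongr; exact abs_inner_unit_le h.norm_eq Z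
      have h4 : κ * ⟪e, D⟫ = (κ * ⟪e, D⟫ - -a * ⟪e, Z⟫) - a * ⟪e, Z⟫ := by ring
      rw [h4]
      exact (abs_sub _ _).trans (add_le_add (h1.trans hG) h3)
    rw [abs_mul] at h2
    have h5 : |κ| * (N / 2) ≤ |κ| * |⟪e, D⟫| := by gcongr
    nlinarith [norm_nonneg Z]
  have hZp : ‖perp e Z‖ ≤ ‖Z‖ / 8 := by
    have h1 := h.le_norm_map_perp Z
    have h2 : perp e (H Z) = κ • perp e D - perp e (κ • D - H Z) := by
      rw [perp_sub, perp_smul]; abel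
    have h3 : ‖perp e (H Z)‖ ≤ |κ| * ‖perp e D‖ + η * ‖Z‖ := by
      rw [h2]
      refine (norm_sub_le _ _).trans (add_le_add ?_ ((norm_perp_le h.norm_eq _).trans hG))
      rw [norm_smul, Real.norm_eq_abs]
    have h4 : |κ| * ‖perp e D‖ ≤ b / 16 * ‖Z‖ := by
      calc |κ| * ‖perp e D‖ ≤ |κ| * (ε * N) := by gcongr
        _ = 2 * ε * (|κ| * (N / 2)) := by ring
        _ ≤ 2 * ε * ((a + 1) * ‖Z‖) := by gcongr
        _ = 2 * (a + 1) * ε * ‖Z‖ := by ring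
        _ ≤ _ := by gcongr
    refine le_of_mul_le_mul_left ?_ hb
    nlinarith [norm_nonneg Z]
  have := norm_le_abs_add_perp h.norm_eq Z
  nlinarith [norm_nonneg Z]

end IsSaddleForm

end Alignment

/-! ### The Hessian as a saddle form, and quadratic approximation -/

section Hessian

variable {n : ℕ}

/-- The Hessian of `f` at `x`, as a linear operator. -/
noncomputable def hessianOp (f : E n → ℝ) (x : E n) : E n →L[ℝ] E n :=
  InnerProductSpace.continuousLinearMapOfBilin (𝕜 := ℝ) (hessian f x)

lemma inner_hessianOp (f : E n → ℝ) (x v w : E n) :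
    ⟪hessianOp f x v, w⟫ = hessian f x v w :=
  InnerProductSpace.continuousLinearMapOfBilin_apply (𝕜 := ℝ) (hessian f x) v w

lemma inner_hessianOp_symm {f : E n → ℝ} {x : E n} (hf : ContDiffAt ℝ 2 f x) (v w : E n) :
    ⟪hessianOp f x v, w⟫ = ⟪v, hessianOp f x w⟫ := by
  rw [real_inner_comm (hessianOp f x w) v, inner_hessianOp, inner_hessianOp]
  exact (hf.isSymmSndFDerivAt (by simp)) v w

lemma inner_gradient (f : E n → ℝ) (x v : E n) : ⟪∇ f x, v⟫ = fderiv ℝ f x v :=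
  InnerProductSpace.toDual_symm_apply

/-- A symmetric operator which is negative on no plane, negative on some line, and injective is a
saddle form. -/
theorem exists_isSaddleForm {H : E n →L[ℝ] E n} (hsymm : ∀ v w, ⟪H v, w⟫ = ⟪v, H w⟫)
    (hinj : ∀ v, H v = 0 → v = 0)
    (hidx : IsGreatest {d : ℕ | ∃ S : Submodule ℝ (E n), Module.finrank ℝ S = d ∧
      ∀ v ∈ S, v ≠ 0 → ⟪H v, v⟫ < 0} 1) :
    ∃ (e : E n) (a b : ℝ), IsSaddleForm H e a b := by
  have hT : (H : E n →ₗ[ℝ] E n).IsSymmetric := fun v w => hsymm v w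
  have hn : Module.finrank ℝ (E n) = n := finrank_euclideanSpace_fin
  obtain ⟨B, ev, hHB⟩ : ∃ (B : OrthonormalBasis (Fin n) ℝ (E n)) (ev : Fin n → ℝ),
      ∀ i, H (B i) = ev i • B i :=
    ⟨hT.eigenvectorBasis hn, hT.eigenvalues hn, fun i => hT.apply_eigenvectorBasis hn i⟩
  have hsum : ∀ v, ⟪H v, v⟫ = ∑ i, ev i * ⟪B i, v⟫ ^ 2 := by
    intro v
    rw [← B.sum_inner_mul_inner]
    refine Finset.sum_congr rfl fun i _ => ?_
    rw [hsymm, hHB, inner_smul_right, real_inner_comm]; ring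
  have hnorm : ∀ v, ‖v‖ ^ 2 = ∑ i, ⟪B i, v⟫ ^ 2 := by
    intro v
    rw [← real_inner_self_eq_norm_sq, ← B.sum_inner_mul_inner]
    refine Finset.sum_congr rfl fun i _ => ?_
    rw [real_inner_comm]; ring
  have hne : ∀ i, ev i ≠ 0 := by
    intro i h0
    have h1 := hinj (B i) (by rw [hHB, h0, zero_smul])
    have h2 := B.orthonormal.1 i
    rw [h1] at h2; simp at h2
  obtain ⟨⟨S, hS, hneg⟩, hub⟩ := hidx
  have hub' : ∀ S : Submodule ℝ (E n), (∀ v ∈ S, v ≠ 0 → ⟪H v, v⟫ < 0) →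
      Module.finrank ℝ S ≤ 1 := fun S hS => hub ⟨S, rfl, hS⟩
  obtain ⟨i₀, hi₀⟩ : ∃ i, ev i < 0 := by
    by_contra! hcon
    have : Nontrivial S := Module.nontrivial_of_finrank_pos (R := ℝ) (by omega)
    obtain ⟨v, hv⟩ := exists_ne (0 : S)
    have h1 := hneg v v.2 (by simpa using hv)
    rw [hsum] at h1
    exact absurd h1 (not_lt.mpr (Finset.sum_nonneg fun i _ => mul_nonneg (hcon i) (sq_nonneg _)))
  -- Two negative eigenvectors would span a plane on which the form is negative definite, against
  -- index one.
  have huniq : ∀ j, j ≠ i₀ → 0 < ev j := by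
    intro j hj
    by_contra! hcon
    have hj0 : ev j < 0 := lt_of_le_of_ne hcon (hne j)
    have hli : LinearIndependent ℝ ![B i₀, B j] := by
      have hinj : Function.Injective ![i₀, j] := by
        intro x y hxy
        fin_cases x <;> fin_cases y <;> first | rfl | exact absurd hxy hj.symm | exact absurd hxy hj
      have h3 : ![B i₀, B j] = B ∘ ![i₀, j] := by
        ext x : 1
        fin_cases x <;> rfl
      rw [h3]
      exact B.orthonormal.linearIndependent.comp _ hinj
    have hdim := finrank_span_eq_card hli
    rw [Fintype.card_fin] at hdim
    suffices hspan : ∀ v ∈ Submodule.span ℝ (Set.range ![B i₀, B j]), v ≠ 0 → ⟪H v, v⟫ < 0 by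
      have := hub' _ hspan
      omega
    intro v hv hv0
    have hv' : v ∈ Submodule.span ℝ {B i₀, B j} := by
      rwa [Matrix.range_cons_cons_empty] at hv
    obtain ⟨s, t, rfl⟩ := Submodule.mem_span_pair.mp hv'
    have o1 : ⟪B i₀, B j⟫ = 0 := B.orthonormal.2 (Ne.symm hj)
    have o2 : ⟪B j, B i₀⟫ = 0 := B.orthonormal.2 hj
    have n1 : ‖B i₀‖ = 1 := B.orthonormal.1 _
    have n2 : ‖B j‖ = 1 := B.orthonormal.1 _
    have hval : ⟪H (s • B i₀ + t • B j), s • B i₀ + t • B j⟫ = ev i₀ * s ^ 2 + ev j * t ^ 2 := by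
      simp only [map_add, map_smul, hHB, inner_add_left, inner_add_right, inner_smul_left,
        inner_smul_right, real_inner_self_eq_norm_sq, o1, o2, n1, n2]
      simp; ring
    rw [hval]
    by_cases hs : s = 0
    · have ht : t ≠ 0 := by rintro rfl; simp [hs] at hv0
      have := mul_neg_of_neg_of_pos hj0 (by positivity : 0 < t ^ 2)
      simp [hs, this]
    · have h3 := mul_neg_of_neg_of_pos hi₀ (by positivity : 0 < s ^ 2)
      have h4 := mul_nonpos_of_nonpos_of_nonneg hj0.le (sq_nonneg t)
      linarith
  have : Nonempty (Fin n) := ⟨i₀⟩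
  obtain ⟨k, hk⟩ := Finite.exists_min fun i => |ev i|
  -- Taking for `b` the least absolute value of all eigenvalues gives both `b ≤ a` and coercivity on
  -- the complement.
  refine ⟨B i₀, |ev i₀|, |ev k|, B.orthonormal.1 _, abs_pos.mpr (hne k), hk i₀, hsymm, ?_, ?_⟩
  · rw [hHB, abs_of_neg hi₀, neg_smul, neg_neg]
  · intro w hw
    rw [hsum, hnorm, Finset.mul_sum]
    refine Finset.sum_le_sum fun i _ => ?_
    by_cases hi : i = i₀
    · rw [hi, hw]; simp
    · have h1 := hk i
      rw [abs_of_pos (huniq i hi)] at h1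
      gcongr

theorem IsNondegenerateCriticalPointOfIndexOne.exists_isSaddleForm {f : E n → ℝ} {x : E n}
    (hf : ContDiffAt ℝ 2 f x) (hx : IsNondegenerateCriticalPointOfIndexOne f x) :
    ∃ (e : E n) (a b : ℝ), IsSaddleForm (hessianOp f x) e a b := by
  refine MountainPass.exists_isSaddleForm (inner_hessianOp_symm hf) ?_ ?_
  · intro v hv
    apply hx.nondegenerate.injective
    ext w
    rw [← inner_hessianOp, hv]; simp
  · simpa only [HasMorseIndex, inner_hessianOp] using hx.index

/-- On the ball of radius `r`, the gradient of `f` is `H (w - x)` and the value of `f` is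
`f x + ⟪H (w - x), w - x⟫ / 2`, up to relative errors `η`. -/
def IsQuadraticApprox (f : E n → ℝ) (x : E n) (H : E n →L[ℝ] E n) (η r : ℝ) : Prop :=
  ∀ w ∈ Metric.ball x r, DifferentiableAt ℝ f w ∧ ‖∇ f w - H (w - x)‖ ≤ η * ‖w - x‖ ∧
    |f w - f x - 1 / 2 * ⟪H (w - x), w - x⟫| ≤ η * ‖w - x‖ ^ 2

/-- The gradient estimate is differentiability of `fderiv ℝ f` at `x`. The value estimate follows
from it by the mean value inequality for `f` minus its quadratic part, on the closed ball of radius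
`‖w - x‖`. -/
theorem exists_isQuadraticApprox {f : E n → ℝ} {x : E n} (hf : ContDiffAt ℝ 2 f x)
    (hx : fderiv ℝ f x = 0) {η : ℝ} (hη : 0 < η) :
    ∃ r : ℝ, 0 < r ∧ IsQuadraticApprox f x (hessianOp f x) η r := by
  have h1 : HasFDerivAt (fderiv ℝ f) (hessian f x) x :=
    ((hf.fderiv_right (m := 1) (by norm_num)).differentiableAt (by simp)).hasFDerivAt
  have h2 : ∀ᶠ w in 𝓝 x, ‖fderiv ℝ f w - hessian f x (w - x)‖ ≤ η * ‖w - x‖ := by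
    have := (hasFDerivAt_iff_isLittleO.mp h1).def hη
    simpa [hx] using this
  have h3 : ∀ᶠ w in 𝓝 x, DifferentiableAt ℝ f w :=
    (hf.eventually (by simp)).mono fun w hw => hw.differentiableAt (by simp)
  obtain ⟨r, hr, hball⟩ := Metric.eventually_nhds_iff_ball.mp (h2.and h3)
  refine ⟨r, hr, fun w hw => ⟨(hball w hw).2, ?_, ?_⟩⟩
  · have h4 : ∇ f w - hessianOp f x (w - x) =
        (InnerProductSpace.toDual ℝ (E n)).symm (fderiv ℝ f w - hessian f x (w - x)) := by
      have h5 : hessianOp f x (w - x) =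
          (InnerProductSpace.toDual ℝ (E n)).symm (hessian f x (w - x)) :=
        ext_inner_right ℝ fun v => by
          rw [inner_hessianOp, InnerProductSpace.toDual_symm_apply]
      rw [map_sub _ (fderiv ℝ f w), h5]; rfl
    rw [h4, LinearIsometryEquiv.norm_map]
    exact (hball w hw).1
  · set φ : E n → ℝ := fun y => f y - 1 / 2 * ⟪hessianOp f x (y - x), y - x⟫ with hφ
    have hsub : Metric.closedBall x ‖w - x‖ ⊆ Metric.ball x r := by
      apply Metric.closedBall_subset_ball
      simpa [dist_eq_norm] using hw
    have hder : ∀ y ∈ Metric.closedBall x ‖w - x‖,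
        HasFDerivWithinAt φ (fderiv ℝ f y - hessian f x (y - x))
          (Metric.closedBall x ‖w - x‖) y := by
      intro y hy
      have hd : HasFDerivAt (fun y => y - x) (ContinuousLinearMap.id ℝ (E n)) y :=
        (hasFDerivAt_id y).sub_const x
      have hq := (((hessianOp f x).hasFDerivAt.comp y hd).inner ℝ hd).const_mul (1 / 2 : ℝ)
      refine (((hball y (hsub hy)).2.hasFDerivAt.sub hq).congr_fderiv ?_).hasFDerivWithinAt
      ext v
      have s1 : ⟪hessianOp f x v, y - x⟫ = ⟪hessianOp f x (y - x), v⟫ := by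
        rw [inner_hessianOp_symm hf, real_inner_comm]
      simp [s1, inner_hessianOp, -map_sub]
      ring
    have hbd : ∀ y ∈ Metric.closedBall x ‖w - x‖,
        ‖fderiv ℝ f y - hessian f x (y - x)‖ ≤ η * ‖w - x‖ := by
      intro y hy
      refine (hball y (hsub hy)).1.trans ?_
      have : ‖y - x‖ ≤ ‖w - x‖ := by simpa [dist_eq_norm] using hy
      gcongr
    have := (convex_closedBall x ‖w - x‖).norm_image_sub_le_of_norm_hasFDerivWithin_le hder hbd
      (Metric.mem_closedBall_self (norm_nonneg _)) (by simp [dist_eq_norm] : w ∈ _)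
    simp only [hφ, sub_self, inner_zero_right, mul_zero, sub_zero, Real.norm_eq_abs] at this
    calc _ = |f w - 1 / 2 * ⟪hessianOp f x (w - x), w - x⟫ - f x| := by congr 1; ring
      _ ≤ _ := this
      _ = _ := by ring

end Hessian

/-! ### First order conditions at closest pairs and bisector minimizers -/

section FirstOrder

variable {n : ℕ}

/-- This is Farkas' lemma for one constraint. A limit extends the hypothesis to `⟪g, v⟫ ≤ 0`;
applied to the part of `d` orthogonal to `g`, it forces that part to vanish. -/
lemma exists_pos_smul_eq {g d : E n} (hg : g ≠ 0) (hd : d ≠ 0)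
    (h : ∀ v, ⟪g, v⟫ < 0 → ⟪d, v⟫ ≤ 0) : ∃ lam : ℝ, 0 < lam ∧ g = lam • d := by
  have hg2 : 0 < ⟪g, g⟫ := real_inner_self_pos.mpr hg
  have h' : ∀ v, ⟪g, v⟫ ≤ 0 → ⟪d, v⟫ ≤ 0 := by
    intro v hv
    have hlim : Tendsto (fun t : ℝ => ⟪d, v - t • g⟫) (𝓝[>] 0) (𝓝 ⟪d, v⟫) := by
      have : Continuous fun t : ℝ => ⟪d, v - t • g⟫ := by fun_prop
      simpa using (this.tendsto 0).mono_left nhdsWithin_le_nhds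
    refine le_of_tendsto hlim ?_
    filter_upwards [self_mem_nhdsWithin] with t ht
    apply h
    rw [inner_sub_right, inner_smul_right]
    have := mul_pos (Set.mem_Ioi.mp ht) hg2
    linarith
  set κ := ⟪g, d⟫ / ⟪g, g⟫ with hκ
  have hv : ⟪g, d - κ • g⟫ = 0 := by
    rw [inner_sub_right, inner_smul_right, hκ, div_mul_cancel₀ _ hg2.ne', sub_self]
  have h1 := h' _ hv.le
  have h2 : ⟪d - κ • g, d - κ • g⟫ ≤ 0 := by
    rw [inner_sub_left, inner_smul_left, hv]; simpa using h1
  have h3 : d = κ • g := sub_eq_zero.mp (real_inner_self_nonpos.mp h2)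
  have h4 : 0 < κ := by
    refine lt_of_le_of_ne ?_ (fun h0 => hd (by rw [h3, ← h0, zero_smul]))
    have h5 := h (-g) (by rw [inner_neg_right]; linarith)
    rw [inner_neg_right] at h5
    rw [hκ, real_inner_comm]
    exact div_nonneg (by linarith) hg2.le
  refine ⟨κ⁻¹, inv_pos.mpr h4, ?_⟩
  conv_rhs => rw [h3]
  rw [smul_smul, inv_mul_cancel₀ h4.ne', one_smul]

/-- A short segment from `p` in direction `v` stays in the sublevel set, hence in the same path
component, so moving along it cannot decrease the distance to `q` to first order. -/
lemma inner_nonpos_of_eventually_mem {f : E n → ℝ} {U : Set (E n)} {l : ℝ} {x p q v : E n}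
    (hp : p ∈ levelComponent f U l x)
    (hmin : ∀ p' ∈ levelComponent f U l x, dist p q ≤ dist p' q)
    (hv : ∀ᶠ t : ℝ in 𝓝[>] 0, p + t • v ∈ {w | f w ≤ l} ∩ U) : ⟪q - p, v⟫ ≤ 0 := by
  obtain ⟨δ, hδ, hIoo⟩ := mem_nhdsGT_iff_exists_Ioo_subset.mp hv
  have hδ' : (0 : ℝ) < δ := hδ
  have hmem : ∀ t ∈ Set.Ioo 0 δ, p + t • v ∈ levelComponent f U l x := by
    intro t ht
    refine JoinedIn.trans hp (JoinedIn.of_segment_subset ?_)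
    rw [segment_eq_image']
    rintro _ ⟨s, hs, rfl⟩
    rcases eq_or_lt_of_le hs.1 with h0 | h0
    · rw [← h0]; simpa using pathComponentIn_subset hp
    · have : p + s • (p + t • v - p) = p + (s * t) • v := by rw [add_sub_cancel_left, smul_smul]
      simp only [this]
      exact hIoo ⟨mul_pos h0 ht.1, (mul_le_of_le_one_left ht.1.le hs.2).trans_lt ht.2⟩
  have key : ∀ t ∈ Set.Ioo 0 δ, 2 * ⟪q - p, v⟫ ≤ t * ‖v‖ ^ 2 := by
    intro t ht
    have h1 := hmin _ (hmem t ht)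
    rw [dist_eq_norm, dist_eq_norm] at h1
    have h2 : ‖p - q‖ ^ 2 ≤ ‖p + t • v - q‖ ^ 2 := by gcongr
    rw [show p + t • v - q = (p - q) + t • v by abel, norm_add_sq_real, inner_smul_right,
      norm_smul, mul_pow, Real.norm_eq_abs, sq_abs] at h2
    have h3 : ⟪p - q, v⟫ = -⟪q - p, v⟫ := by rw [← neg_sub q p, inner_neg_left]
    rw [h3] at h2
    refine le_of_mul_le_mul_left ?_ ht.1
    nlinarith
  have hlim : Tendsto (fun t : ℝ => t * ‖v‖ ^ 2) (𝓝[>] 0) (𝓝 0) := by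
    have : Continuous fun t : ℝ => t * ‖v‖ ^ 2 := by fun_prop
    simpa using (this.tendsto 0).mono_left nhdsWithin_le_nhds
  have := ge_of_tendsto hlim (b := 2 * ⟪q - p, v⟫) (by
    filter_upwards [Ioo_mem_nhdsGT hδ'] with t ht using key t ht)
  linarith

lemma hasDerivAt_comp_line {f : E n → ℝ} {y v : E n} {t : ℝ}
    (hf : DifferentiableAt ℝ f (y + t • v)) :
    HasDerivAt (fun s : ℝ => f (y + s • v)) ⟪∇ f (y + t • v), v⟫ t := by
  have h1 : HasDerivAt (fun s : ℝ => y + s • v) v t := by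
    simpa using ((hasDerivAt_id t).smul_const v).const_add y
  rw [inner_gradient]
  exact hf.hasFDerivAt.comp_hasDerivAt t h1

lemma hasDerivAt_line {f : E n → ℝ} {p : E n} (hf : DifferentiableAt ℝ f p) (v : E n) :
    HasDerivAt (fun t : ℝ => f (p + t • v)) ⟪∇ f p, v⟫ 0 := by
  simpa using hasDerivAt_comp_line (y := p) (v := v) (t := 0) (by simpa using hf)

/-- First order conditions for a point `p` of a level component closest to `q`. -/
theorem gradient_eq_of_closest {f : E n → ℝ} {U : Set (E n)} {l : ℝ} {x p q : E n}
    (hU : IsOpen U) (hp : p ∈ levelComponent f U l x)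
    (hmin : ∀ p' ∈ levelComponent f U l x, dist p q ≤ dist p' q)
    (hpq : p ≠ q) (hf : DifferentiableAt ℝ f p) (hg : ∇ f p ≠ 0) :
    f p = l ∧ ∃ lam : ℝ, 0 < lam ∧ ∇ f p = lam • (q - p) := by
  have hpU := pathComponentIn_subset hp
  have hline : ∀ v : E n, Tendsto (fun t : ℝ => p + t • v) (𝓝[>] 0) (𝓝 p) := by
    intro v
    have : Continuous fun t : ℝ => p + t • v := by fun_prop
    simpa using (this.tendsto 0).mono_left nhdsWithin_le_nhds
  have hd : q - p ≠ 0 := sub_ne_zero.mpr hpq.symm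
  constructor
  -- Below level `l` every direction would be admissible, including the one towards `q`.
  · refine le_antisymm hpU.1 (not_lt.mp fun hlt => ?_)
    have := inner_nonpos_of_eventually_mem (v := q - p) hp hmin (by
      filter_upwards [(hline (q - p)).eventually (hf.continuousAt.eventually (gt_mem_nhds hlt)),
        (hline (q - p)).eventually (hU.mem_nhds hpU.2)] with t h1 h2
      exact ⟨le_of_lt h1, h2⟩)
    exact hd (real_inner_self_nonpos.mp this)
  · refine exists_pos_smul_eq hg hd fun v hv => inner_nonpos_of_eventually_mem hp hmin ?_
    have h1 : ∀ᶠ t : ℝ in 𝓝[>] 0, f (p + t • v) < f p := by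
      have h2 := (hasDerivAt_line hf v).hasDerivWithinAt (s := Set.Ioi 0)
      rw [hasDerivWithinAt_iff_tendsto_slope' (by simp)] at h2
      filter_upwards [h2.eventually (gt_mem_nhds hv), self_mem_nhdsWithin] with t h3 h4
      have h4' : (0 : ℝ) < t := h4
      rw [slope_def_field, sub_zero, div_lt_iff₀ h4', zero_mul] at h3
      simpa using h3
    filter_upwards [h1, (hline v).eventually (hU.mem_nhds hpU.2)] with t h3 h4
    exact ⟨h3.le.trans hpU.1, h4⟩

/-- At a minimizer over the bisector of `p` and `q`, the gradient is parallel to `q - p`. -/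
theorem IsBisectorMinimizer.exists_gradient_eq {f : E n → ℝ} {U : Set (E n)} {p q z : E n}
    (hU : IsOpen U) (h : IsBisectorMinimizer f U p q z) (hf : DifferentiableAt ℝ f z) :
    ∃ κ : ℝ, ∇ f z = κ • (q - p) := by
  have horth : ∀ v, ⟪v, q - p⟫ = 0 → ⟪∇ f z, v⟫ = 0 := by
    intro v hv
    have hmin : IsLocalMin (fun t : ℝ => f (z + t • v)) 0 := by
      have hline : Tendsto (fun t : ℝ => z + t • v) (𝓝 0) (𝓝 z) := by
        have : Continuous fun t : ℝ => z + t • v := by fun_prop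
        simpa using this.tendsto 0
      filter_upwards [hline.eventually (hU.mem_nhds h.mem)] with t ht
      have h1 := h.mem_bisector
      rw [AffineSubspace.mem_perpBisector_iff_inner_eq_zero] at h1
      simpa using h.le (z + t • v) (by
        rw [AffineSubspace.mem_perpBisector_iff_inner_eq_zero]
        rw [vsub_eq_sub, vsub_eq_sub] at h1 ⊢
        rw [show z + t • v - midpoint ℝ p q = (z - midpoint ℝ p q) + t • v by abel,
          inner_add_left, h1, inner_smul_left, hv]
        simp) ht
    exact hmin.hasDerivAt_eq_zero (hasDerivAt_line hf v)
  rcases eq_or_ne (q - p) 0 with h0 | h0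
  · refine ⟨0, ?_⟩
    have := horth (∇ f z) (by rw [h0, inner_zero_right])
    rw [zero_smul]; exact inner_self_eq_zero.mp this
  · set κ := ⟪∇ f z, q - p⟫ / ⟪q - p, q - p⟫ with hκ
    have h1 : ⟪∇ f z - κ • (q - p), q - p⟫ = 0 := by
      rw [inner_sub_left, inner_smul_left, hκ]
      simp only [conj_trivial]
      rw [div_mul_cancel₀ _ (real_inner_self_pos.mpr h0).ne', sub_self]
    have h2 := horth _ h1
    refine ⟨κ, sub_eq_zero.mp (inner_self_eq_zero (𝕜 := ℝ).mp ?_)⟩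
    rw [inner_sub_left, h2, inner_smul_left, real_inner_comm, h1]; simp

end FirstOrder

/-! ### Aligned pairs and the local estimates near the saddle -/

section Aligned

variable {n : ℕ}

/-- Up to the relative error `ε`, the points `p` and `q` are opposite points with respect to `x`
on the line through `x` in direction `e`. -/
structure IsAligned (e : E n) (ε : ℝ) (x p q : E n) : Prop where
  ne : q - p ≠ 0
  add_le : ‖(p - x) + (q - x)‖ ≤ ε * ‖q - p‖
  perp_le : ‖perp e (q - p)‖ ≤ ε * ‖q - p‖

namespace IsAligned

variable {e x p q : E n} {ε : ℝ}

lemma symm (h : IsAligned e ε x p q) : IsAligned e ε x q p := by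
  have h1 : p - q = -(q - p) := by abel
  refine ⟨?_, ?_, ?_⟩
  · rw [h1]; exact neg_ne_zero.mpr h.ne
  · rw [add_comm, norm_sub_rev]; exact h.add_le
  · have h2 : perp e (p - q) = -perp e (q - p) := by rw [perp_sub, perp_sub]; abel
    rw [h2, norm_neg, norm_sub_rev]; exact h.perp_le

lemma norm_pos (h : IsAligned e ε x p q) : 0 < ‖q - p‖ := norm_pos_iff.mpr h.ne

lemma eq_half (p q x : E n) :
    p - x = (1 / 2 : ℝ) • (((p - x) + (q - x)) - (q - p)) := by module

lemma left_facts (h : IsAligned e ε x p q) (he : ‖e‖ = 1) (hε : ε ≤ 1 / 4) :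
    ‖p - x‖ ≤ ‖q - p‖ ∧ ‖perp e (p - x)‖ ≤ ε * ‖q - p‖ ∧ ‖q - p‖ / 4 ≤ |⟪e, p - x⟫| := by
  have hN := h.norm_pos
  set S := (p - x) + (q - x) with hS
  have hX : p - x = (1 / 2 : ℝ) • (S - (q - p)) := eq_half p q x
  have hSN := h.add_le
  have hDN := h.perp_le
  have hSp := (norm_perp_le he S).trans hSN
  have hSu := (abs_inner_unit_le he S).trans hSN
  have hDu := norm_le_abs_add_perp he (q - p)
  have hhalf : ‖(1 / 2 : ℝ)‖ = 1 / 2 := by norm_num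
  refine ⟨?_, ?_, ?_⟩
  · rw [hX, norm_smul, hhalf]
    have := norm_sub_le S (q - p)
    nlinarith
  · rw [hX, perp_smul, perp_sub, norm_smul, hhalf]
    have := norm_sub_le (perp e S) (perp e (q - p))
    linarith
  · rw [hX, inner_smul_right, inner_sub_right, abs_mul, abs_of_pos (by norm_num : (0 : ℝ) < 1 / 2)]
    have := abs_sub_abs_le_abs_sub ⟪e, q - p⟫ ⟪e, S⟫
    rw [abs_sub_comm] at this
    nlinarith

lemma right_facts (h : IsAligned e ε x p q) (he : ‖e‖ = 1) (hε : ε ≤ 1 / 4) :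
    ‖q - x‖ ≤ ‖q - p‖ ∧ ‖perp e (q - x)‖ ≤ ε * ‖q - p‖ ∧ ‖q - p‖ / 4 ≤ |⟪e, q - x⟫| := by
  rw [norm_sub_rev q p]
  exact h.symm.left_facts he hε

/-- With `u`, `v` the two components, `4 u v = (u + v)² - (v - u)²`, and alignment makes the sum
smaller than the difference. So the hyperplane orthogonal to `e` separates `p` from `q`. -/
lemma inner_mul_inner_neg (h : IsAligned e ε x p q) (he : ‖e‖ = 1) (hε : ε ≤ 1 / 4) :
    ⟪e, p - x⟫ * ⟪e, q - x⟫ < 0 := by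
  have hN := h.norm_pos
  set S := (p - x) + (q - x) with hS
  have hSu := (abs_inner_unit_le he S).trans h.add_le
  have hDu := norm_le_abs_add_perp he (q - p)
  have hDN := h.perp_le
  have h1 : |⟪e, S⟫| < |⟪e, q - p⟫| := by nlinarith
  have h2 := sq_lt_sq.mpr h1
  have h3 : ⟪e, S⟫ = ⟪e, p - x⟫ + ⟪e, q - x⟫ := inner_add_right _ _ _
  have h4 : ⟪e, q - p⟫ = ⟪e, q - x⟫ - ⟪e, p - x⟫ := by
    rw [← inner_sub_right]; congr 1; abel
  rw [h3, h4] at h2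
  nlinarith

lemma inner_bisector {z : E n} (hz : z ∈ AffineSubspace.perpBisector p q) :
    ⟪z - x, q - p⟫ = 1 / 2 * ⟪(p - x) + (q - x), q - p⟫ := by
  rw [AffineSubspace.mem_perpBisector_iff_inner_eq_zero, vsub_eq_sub, vsub_eq_sub] at hz
  have h1 : z - midpoint ℝ p q = (z - x) - (1 / 2 : ℝ) • ((p - x) + (q - x)) := by
    rw [midpoint_eq_smul_add, invOf_eq_inv]; module
  rw [h1, inner_sub_left, inner_smul_left] at hz
  simp only [conj_trivial] at hz
  linarith

lemma mem_bisector_of_inner {z : E n}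
    (hz : ⟪z - x, q - p⟫ = 1 / 2 * ⟪(p - x) + (q - x), q - p⟫) :
    z ∈ AffineSubspace.perpBisector p q := by
  rw [AffineSubspace.mem_perpBisector_iff_inner_eq_zero, vsub_eq_sub, vsub_eq_sub]
  have h1 : z - midpoint ℝ p q = (z - x) - (1 / 2 : ℝ) • ((p - x) + (q - x)) := by
    rw [midpoint_eq_smul_add, invOf_eq_inv]; module
  rw [h1, inner_sub_left, inner_smul_left]
  simp only [conj_trivial]
  linarith

lemma abs_inner_bisector_le {z : E n} (h : IsAligned e ε x p q)
    (hz : z ∈ AffineSubspace.perpBisector p q) :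
    |⟪z - x, q - p⟫| ≤ ε / 2 * ‖q - p‖ ^ 2 := by
  rw [inner_bisector (x := x) hz, abs_mul, abs_of_pos (by norm_num : (0 : ℝ) < 1 / 2)]
  have h1 := abs_real_inner_le_norm ((p - x) + (q - x)) (q - p)
  have h2 := h.add_le
  have h3 := h.norm_pos
  nlinarith

end IsAligned

/-- The local facts about `f` near the saddle point `x` used by the analysis of the algorithm; the
closest pairs in the ball of radius `r` are aligned up to a relative error `ε`. -/
structure IsGoodRadius (f : E n → ℝ) (x e : E n) (c C ε r : ℝ) : Prop where
  norm_e : ‖e‖ = 1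
  pos : 0 < r
  C_pos : 0 < C
  eps_pos : 0 < ε
  eps_le : ε ≤ 1 / 4
  eps_sq : C * (2 * ε) ^ 2 < c
  differentiableAt : ∀ w ∈ Metric.ball x r, DifferentiableAt ℝ f w
  abs_sub_le : ∀ w ∈ Metric.ball x r, |f w - f x| ≤ C * ‖w - x‖ ^ 2
  le_of_inner_eq_zero : ∀ w ∈ Metric.ball x r, ⟪e, w - x⟫ = 0 → f x ≤ f w
  closest : ∀ (U : Set (E n)) (x₁ y₁ p q : E n), IsOpen U → IsClosestPair f U x₁ y₁ p q →
    p ≠ q → f x₁ < f x → p ∈ Metric.ball x r → q ∈ Metric.ball x r →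
    f p = f x₁ ∧ f q = f x₁ ∧ IsAligned e ε x p q
  value_left : ∀ p q : E n, IsAligned e ε x p q → p ∈ Metric.ball x r → ∀ t : ℝ, 0 ≤ t → t ≤ 1 →
    f (x + t • (p - x)) - f x ≤ -c * t ^ 2 * ‖q - p‖ ^ 2
  minimizer : ∀ (U : Set (E n)) (p q z : E n) (δ : ℝ), IsOpen U → IsBisectorMinimizer f U p q z →
    IsAligned e ε x p q → z ∈ Metric.ball x r → |⟪z - x, q - p⟫| ≤ δ * ‖q - p‖ ^ 2 →
    ‖z - x‖ ≤ 4 * δ * ‖q - p‖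

/-- The `e`-component contributes at most `-a / 16` to the form, in units of `N ^ 2`, and the
orthogonal part at most `a / 32`. Half their sum is `-a / 64`, and the error term uses up half of
that. -/
lemma IsSaddleForm.value_le {H : E n →L[ℝ] E n} {e : E n} {a b ε η N : ℝ} {X : E n}
    (h : IsSaddleForm H e a b) (hε : ‖H‖ * ε ^ 2 ≤ a / 32) (hη : η ≤ a / 128)
    (h1 : ‖X‖ ≤ N) (h2 : ‖perp e X‖ ≤ ε * N) (h3 : N / 4 ≤ |⟪e, X⟫|) :
    1 / 2 * ⟪H X, X⟫ + η * ‖X‖ ^ 2 ≤ -(a / 128) * N ^ 2 := by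
  have hN : 0 ≤ N := (norm_nonneg X).trans h1
  have ha := h.a_pos
  have h4 := h.inner_map_le X
  have h5 : a * (N / 4) ^ 2 ≤ a * ⟪e, X⟫ ^ 2 := by
    rw [← sq_abs ⟪e, X⟫]; gcongr
  have h6 : ‖H‖ * ‖perp e X‖ ^ 2 ≤ a / 32 * N ^ 2 := by
    calc ‖H‖ * ‖perp e X‖ ^ 2 ≤ ‖H‖ * (ε * N) ^ 2 := by gcongr
      _ = ‖H‖ * ε ^ 2 * N ^ 2 := by ring
      _ ≤ _ := by gcongr
  have h7 : η * ‖X‖ ^ 2 ≤ a / 128 * N ^ 2 := by gcongr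
  nlinarith

/-- The order of quantifiers is essential: `c` and `C` come before `ε`, and only the radius depends
on `ε`. Superlinear convergence rests on shrinking `ε` with `c` and `C` fixed. The bound `ε ≤ ε₃`
secures `eps_sq`, which makes one pass raise the level and contract the pair. -/
theorem exists_isGoodRadius {f : E n → ℝ} {x : E n} (hf : ContDiffAt ℝ 2 f x)
    (hx : fderiv ℝ f x = 0) {e : E n} {a b : ℝ} (h : IsSaddleForm (hessianOp f x) e a b) :
    ∃ c C ε₁ : ℝ, 0 < c ∧ 0 < C ∧ 0 < ε₁ ∧ ∀ ε, 0 < ε → ε ≤ ε₁ →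
      ∃ r : ℝ, IsGoodRadius f x e c C ε r := by
  have ha := h.a_pos
  have hb := h.pos
  set H := hessianOp f x with hH
  obtain ⟨ε₂, hε₂, η₂, hη₂, hZ⟩ := h.exists_norm_le_of_gradient_parallel
  set C := ‖H‖ + 1 with hC
  have hCp : 0 < C := by positivity
  set ε₃ := Real.sqrt (a / (1024 * C)) with hε₃
  have hε₃p : 0 < ε₃ := Real.sqrt_pos.mpr (by positivity)
  have hε₃sq : C * ε₃ ^ 2 = a / 1024 := by
    rw [hε₃, Real.sq_sqrt (by positivity)]; field_simp
  refine ⟨a / 128, C, min (1 / 4) (min ε₂ ε₃), by positivity, hCp, by positivity, ?_⟩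
  intro ε hε hε1
  have hε4 : ε ≤ 1 / 4 := hε1.trans (min_le_left _ _)
  have hεε₂ : ε ≤ ε₂ := hε1.trans ((min_le_right _ _).trans (min_le_left _ _))
  have hεε₃ : ε ≤ ε₃ := hε1.trans ((min_le_right _ _).trans (min_le_right _ _))
  have hεsq : C * ε ^ 2 ≤ a / 1024 := by rw [← hε₃sq]; gcongr
  obtain ⟨η₁, hη₁, hal⟩ := h.exists_align hε
  set η := min (min η₁ η₂) (min (a / 128) (min (b / 2) 1)) with hηdef
  have hη : 0 < η := by positivity
  have hηη₁ : η ≤ η₁ := (min_le_left _ _).trans (min_le_left _ _)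
  have hηη₂ : η ≤ η₂ := (min_le_left _ _).trans (min_le_right _ _)
  have hηa : η ≤ a / 128 := (min_le_right _ _).trans (min_le_left _ _)
  have hηb : η ≤ b / 2 := (min_le_right _ _).trans ((min_le_right _ _).trans (min_le_left _ _))
  have hη1 : η ≤ 1 := (min_le_right _ _).trans ((min_le_right _ _).trans (min_le_right _ _))
  obtain ⟨r, hr, happ⟩ := exists_isQuadraticApprox hf hx hη
  have hHε : ‖H‖ * ε ^ 2 ≤ a / 32 := by
    have : ‖H‖ * ε ^ 2 ≤ C * ε ^ 2 := by gcongr; linarith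
    linarith
  have hgrad : ∀ w ∈ Metric.ball x r, w ≠ x → ∇ f w ≠ 0 := by
    intro w hw hwx h0
    have h1 := (happ w hw).2.1
    rw [h0, zero_sub, norm_neg] at h1
    have h2 := h.le_norm_map (w - x)
    have h3 : 0 < ‖w - x‖ := norm_pos_iff.mpr (sub_ne_zero.mpr hwx)
    nlinarith
  refine ⟨r, h.norm_eq, hr, hCp, hε, hε4, by linarith, fun w hw => (happ w hw).1, ?_, ?_, ?_, ?_, ?_⟩
  · intro w hw
    have h1 := (happ w hw).2.2
    have h2 := abs_real_inner_le_norm (H (w - x)) (w - x)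
    have h3 := H.le_opNorm (w - x)
    have h4 : ‖H (w - x)‖ * ‖w - x‖ ≤ ‖H‖ * ‖w - x‖ ^ 2 := by
      nlinarith [norm_nonneg (w - x)]
    have h5 : η * ‖w - x‖ ^ 2 ≤ 1 * ‖w - x‖ ^ 2 := by gcongr
    have h6 : 0 ≤ ‖H‖ * ‖w - x‖ ^ 2 := by positivity
    rw [hC, add_mul]
    rw [abs_le] at h1 h2 ⊢
    constructor <;> linarith
  · intro w hw h0
    have h1 := (abs_le.mp (happ w hw).2.2).1
    have h2 := h.coercive _ h0
    have h3 : η * ‖w - x‖ ^ 2 ≤ b / 2 * ‖w - x‖ ^ 2 := by gcongr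
    linarith
  · intro U x₁ y₁ p q hU hcl hpq hx₁ hp hq
    have hpx : p ≠ x := by
      rintro rfl
      exact absurd ((pathComponentIn_subset hcl.left_mem).1 : f p ≤ f x₁) (not_le.mpr hx₁)
    have hqx : q ≠ x := by
      rintro rfl
      exact absurd ((pathComponentIn_subset hcl.right_mem).1 : f q ≤ f x₁) (not_le.mpr hx₁)
    obtain ⟨hfp, lam, hlam, hgp⟩ := gradient_eq_of_closest hU hcl.left_mem
      (fun p' hp' => hcl.dist_le p' hp' q hcl.right_mem) hpq (happ p hp).1 (hgrad p hp hpx)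
    obtain ⟨hfq, mu, hmu, hgq⟩ := gradient_eq_of_closest hU hcl.right_mem
      (fun q' hq' => by simpa only [dist_comm] using hcl.dist_le p hcl.left_mem q' hq')
      hpq.symm (happ q hq).1 (hgrad q hq hqx)
    have hD : (q - x) - (p - x) = q - p := by abel
    have hne : q - p ≠ 0 := sub_ne_zero.mpr hpq.symm
    have h1 := (happ p hp).2.1
    have h2 := (happ q hq).2.1
    have h3 := (happ p hp).2.2
    have h4 := (happ q hq).2.2
    rw [hgp, ← hD] at h1
    rw [hgq, show mu • (p - q) = -(mu • ((q - x) - (p - x))) by module] at h2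
    rw [hfp] at h3
    rw [hfq] at h4
    obtain ⟨h5, h6⟩ := hal (by rwa [hD]) hη.le hηη₁ hlam hmu h1 h2 h3 h4
    rw [hD] at h5 h6
    exact ⟨hfp, hfq, hne, h5, h6⟩
  · intro p q hpq hp t ht0 ht1
    obtain ⟨h1, h2, h3⟩ := hpq.left_facts h.norm_eq hε4
    have h4 := h.value_le hHε hηa h1 h2 h3
    have hw : x + t • (p - x) ∈ Metric.ball x r := by
      rw [mem_ball_iff_norm] at hp ⊢
      rw [add_sub_cancel_left, norm_smul, Real.norm_of_nonneg ht0]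
      exact (mul_le_of_le_one_left (norm_nonneg _) ht1).trans_lt hp
    have h5 := (abs_le.mp (happ _ hw).2.2).2
    rw [add_sub_cancel_left, map_smul, inner_smul_left, inner_smul_right, norm_smul, mul_pow,
      Real.norm_eq_abs, sq_abs] at h5
    simp only [conj_trivial] at h5
    have h6 := mul_le_mul_of_nonneg_left h4 (sq_nonneg t)
    linarith
  · intro U p q z δ hU hmin hpq hz hin
    obtain ⟨κ, hκ⟩ := hmin.exists_gradient_eq hU (happ z hz).1
    have h1 := (happ z hz).2.1
    rw [hκ] at h1
    exact hZ hpq.ne hη.le hηη₂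
      (hpq.perp_le.trans (by gcongr)) h1 hin

namespace IsGoodRadius

variable {f : E n → ℝ} {x e : E n} {c C ε r : ℝ}

lemma mono {s : ℝ} (h : IsGoodRadius f x e c C ε r) (hs : 0 < s) (hsr : s ≤ r) :
    IsGoodRadius f x e c C ε s := by
  have hsub : Metric.ball x s ⊆ Metric.ball x r := Metric.ball_subset_ball hsr
  exact ⟨h.norm_e, hs, h.C_pos, h.eps_pos, h.eps_le, h.eps_sq, fun w hw => h.differentiableAt w (hsub hw),
    fun w hw => h.abs_sub_le w (hsub hw), fun w hw => h.le_of_inner_eq_zero w (hsub hw),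
    fun U x₁ y₁ p q h1 h2 h3 h4 h5 h6 => h.closest U x₁ y₁ p q h1 h2 h3 h4 (hsub h5) (hsub h6),
    fun p q h1 h2 => h.value_left p q h1 (hsub h2),
    fun U p q z δ h1 h2 h3 h4 => h.minimizer U p q z δ h1 h2 h3 (hsub h4)⟩

lemma c_pos (h : IsGoodRadius f x e c C ε r) : 0 < c := by
  have := h.C_pos
  exact lt_of_le_of_lt (by positivity) h.eps_sq

lemma continuousOn (h : IsGoodRadius f x e c C ε r) : ContinuousOn f (Metric.ball x r) :=
  fun w hw => (h.differentiableAt w hw).continuousAt.continuousWithinAt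

lemma value_right (h : IsGoodRadius f x e c C ε r) {p q : E n} (hpq : IsAligned e ε x p q)
    (hq : q ∈ Metric.ball x r) {t : ℝ} (ht0 : 0 ≤ t) (ht1 : t ≤ 1) :
    f (x + t • (q - x)) - f x ≤ -c * t ^ 2 * ‖q - p‖ ^ 2 := by
  rw [norm_sub_rev]
  exact h.value_left q p hpq.symm hq t ht0 ht1

end IsGoodRadius

end Aligned

/-! ### The furthest point on a segment -/

section Furthest

variable {n : ℕ}

lemma segment_subset_segment_left {p z r : E n} (hr : r ∈ segment ℝ p z) :
    segment ℝ p r ⊆ segment ℝ p z :=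
  (convex_segment p z).segment_subset (left_mem_segment ℝ p z) hr

/-- The furthest point of the algorithm exists. -/
theorem exists_isFurthestPoint {f : E n → ℝ} {p z : E n} (hf : ContinuousOn f (segment ℝ p z))
    (hpz : f p ≤ f z) : ∃ p', IsFurthestPoint f p z p' := by
  set g : ℝ → ℝ := fun t => f (p + t • (z - p)) with hg
  have hmaps : Set.MapsTo (fun t : ℝ => p + t • (z - p)) (Set.Icc 0 1) (segment ℝ p z) := by
    intro t ht; rw [segment_eq_image']; exact ⟨t, ht, rfl⟩
  have hgc : ContinuousOn g (Set.Icc 0 1) := hf.comp (by fun_prop) hmaps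
  -- `A` consists of the parameters `t` for which the whole initial piece up to `t` stays below `f
  -- z`; written as an intersection over proportions `τ`, it is visibly closed.
  set A : Set ℝ := ⋂ τ ∈ Set.Icc (0 : ℝ) 1, {t ∈ Set.Icc (0 : ℝ) 1 | g (τ * t) ≤ f z} with hA
  have hAc : IsCompact A := by
    refine (isCompact_Icc (a := (0 : ℝ)) (b := 1)).of_isClosed_subset ?_ ?_
    · refine isClosed_biInter fun τ hτ => ?_
      have : ContinuousOn (fun t => g (τ * t)) (Set.Icc 0 1) :=
        hgc.comp (by fun_prop) fun t ht => ⟨mul_nonneg hτ.1 ht.1, mul_le_one₀ hτ.2 ht.1 ht.2⟩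
      exact this.preimage_isClosed_of_isClosed isClosed_Icc isClosed_Iic
    · intro t ht
      exact (Set.mem_iInter₂.mp ht 1 (by simp)).1
  have hA0 : (0 : ℝ) ∈ A := by
    refine Set.mem_iInter₂.mpr fun τ _ => ⟨by simp, ?_⟩
    simpa [hg] using hpz
  obtain ⟨T, hTA, hTmax⟩ := hAc.exists_isGreatest ⟨0, hA0⟩
  have hT : T ∈ Set.Icc (0 : ℝ) 1 := (Set.mem_iInter₂.mp hTA 1 (by simp)).1
  refine ⟨p + T • (z - p), hmaps hT, ?_, ?_⟩
  · intro w hw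
    rw [segment_eq_image'] at hw
    obtain ⟨τ, hτ, rfl⟩ := hw
    have := (Set.mem_iInter₂.mp hTA τ hτ).2
    simpa [hg, smul_smul] using this
  · intro r hr hle
    rw [segment_eq_image'] at hr
    obtain ⟨s, hs, rfl⟩ := hr
    have hsA : s ∈ A := by
      refine Set.mem_iInter₂.mpr fun τ hτ => ⟨hs, ?_⟩
      have := hle (p + τ • (p + s • (z - p) - p)) (by
        rw [segment_eq_image']; exact ⟨τ, hτ, rfl⟩)
      simpa [hg, smul_smul] using this
    have hsT := hTmax hsA
    simp only [dist_self_add_right, norm_smul, Real.norm_of_nonneg hs.1, Real.norm_of_nonneg hT.1]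
    gcongr

/-- If `f p < f z`, the furthest point has value `f z`. -/
theorem IsFurthestPoint.eq_value {f : E n → ℝ} {p z p' : E n} (h : IsFurthestPoint f p z p')
    (hf : ContinuousOn f (segment ℝ p z)) (hpz : f p < f z) : f p' = f z := by
  refine le_antisymm (h.le p' (right_mem_segment ℝ p p')) (not_lt.mp fun hlt => ?_)
  have hpz' : p ≠ z := fun h0 => by rw [h0] at hpz; exact lt_irrefl _ hpz
  have hD : 0 < ‖z - p‖ := norm_pos_iff.mpr (sub_ne_zero.mpr hpz'.symm)
  obtain ⟨s, hs, hs'⟩ := (segment_eq_image' ℝ p z ▸ h.mem :)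
  set g : ℝ → ℝ := fun t => f (p + t • (z - p)) with hg
  have hmaps : Set.MapsTo (fun t : ℝ => p + t • (z - p)) (Set.Icc 0 1) (segment ℝ p z) := by
    intro t ht; rw [segment_eq_image']; exact ⟨t, ht, rfl⟩
  have hgc : ContinuousOn g (Set.Icc 0 1) := hf.comp (by fun_prop) hmaps
  have hgs : g s = f p' := by rw [← hs']
  have hs1 : s < 1 := by
    refine lt_of_le_of_ne hs.2 fun h1 => ?_
    rw [← hs', h1] at hlt
    simp at hlt
  have hev : ∀ᶠ t in 𝓝[Set.Icc 0 1] s, g t < f z :=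
    (hgc s hs).eventually (gt_mem_nhds (by rw [hgs]; exact hlt))
  obtain ⟨δ, hδ, hball⟩ := Metric.mem_nhdsWithin_iff.mp hev
  set t := min (s + δ / 2) 1 with ht
  have hst : s < t := lt_min (by linarith) hs1
  have ht01 : t ∈ Set.Icc (0 : ℝ) 1 := ⟨hs.1.trans hst.le, min_le_right _ _⟩
  have hle : ∀ w ∈ segment ℝ p (p + t • (z - p)), f w ≤ f z := by
    intro w hw
    rw [segment_eq_image'] at hw
    obtain ⟨τ, hτ, rfl⟩ := hw
    have hτt : τ * t ∈ Set.Icc (0 : ℝ) 1 :=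
      ⟨mul_nonneg hτ.1 ht01.1, mul_le_one₀ hτ.2 ht01.1 ht01.2⟩
    have hτt' : τ * t ≤ t := mul_le_of_le_one_left ht01.1 hτ.2
    have e1 : p + τ • (p + t • (z - p) - p) = p + (τ * t) • (z - p) := by
      rw [add_sub_cancel_left, smul_smul]
    simp only [e1]
    rcases le_or_gt (τ * t) s with hc | hc
    · rcases eq_or_lt_of_le hs.1 with h0 | h0
      · have : τ * t = 0 := le_antisymm (h0 ▸ hc) hτt.1
        rw [this]; simpa using hpz.le
      · apply h.le
        rw [← hs', segment_eq_image']
        refine ⟨τ * t / s, ⟨div_nonneg hτt.1 hs.1, div_le_one_of_le₀ hc hs.1⟩, ?_⟩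
        simp only [add_sub_cancel_left, smul_smul]
        rw [div_mul_cancel₀ _ h0.ne']
    · refine le_of_lt (hball ⟨?_, hτt⟩)
      rw [Metric.mem_ball, Real.dist_eq, abs_of_pos (by linarith)]
      have : t ≤ s + δ / 2 := min_le_left _ _
      linarith
  have := h.furthest _ (hmaps ht01) hle
  rw [← hs'] at this
  simp only [dist_self_add_right, norm_smul, Real.norm_of_nonneg hs.1,
    Real.norm_of_nonneg ht01.1] at this
  have := le_of_mul_le_mul_right this hD
  linarith

lemma IsFurthestPoint.eq_right {f : E n → ℝ} {p z p' : E n} (h : IsFurthestPoint f p z p')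
    (hle : ∀ w ∈ segment ℝ p z, f w ≤ f z) : p' = z := by
  have h1 := h.furthest z (right_mem_segment ℝ p z) hle
  obtain ⟨s, hs, hs'⟩ := (segment_eq_image' ℝ p z ▸ h.mem :)
  rcases eq_or_ne (z - p) 0 with h0 | h0
  · rw [← hs']; simp only [h0, smul_zero, add_zero]; exact (sub_eq_zero.mp h0).symm
  · have hD : 0 < ‖z - p‖ := norm_pos_iff.mpr h0
    rw [← hs', dist_comm p z, dist_eq_norm z p] at h1
    simp only [dist_self_add_right, norm_smul, Real.norm_of_nonneg hs.1] at h1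
    have h2 : s = 1 := le_antisymm hs.2 (le_of_mul_le_mul_right (by linarith) hD)
    rw [← hs', h2]; simp

end Furthest

/-! ### One pass of the algorithm -/

section Step

variable {n : ℕ} {f : E n → ℝ} {xb e : E n} {c C ε r : ℝ}

namespace IsGoodRadius

/-- On the bisector `⟪w - xb, q - p⟫` equals half of the quantity in `hσ`, which lies between its
values at `p` and at `xb`. So the bisector meets the segment from `xb` to `p`, along which `f` is
below `f xb` except at `xb`. -/
lemma exists_crossing_of_nonpos (h : IsGoodRadius f xb e c C ε r) {p q : E n}
    (hpq : IsAligned e ε xb p q) (hp : p ∈ Metric.ball xb r)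
    (hσ : ⟪(p - xb) + (q - xb), q - p⟫ ≤ 0) :
    ∃ w ∈ AffineSubspace.perpBisector p q, ‖w - xb‖ ≤ ‖p - xb‖ ∧ (w = xb ∨ f w < f xb) := by
  have hN := hpq.norm_pos
  set σ := ⟪(p - xb) + (q - xb), q - p⟫ with hσdef
  have hP : ⟪p - xb, q - p⟫ = 1 / 2 * (σ - ‖q - p‖ ^ 2) := by
    conv_lhs => rw [IsAligned.eq_half p q xb]
    rw [inner_smul_left, inner_sub_left, real_inner_self_eq_norm_sq]
    simp [hσdef]
  have hneg : σ - ‖q - p‖ ^ 2 < 0 := by have := sq_pos_of_pos hN; linarith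
  set t := σ / (σ - ‖q - p‖ ^ 2) with ht
  have ht0 : 0 ≤ t := div_nonneg_of_nonpos hσ hneg.le
  have ht1 : t ≤ 1 := by
    rw [ht, div_le_one_of_neg hneg]; nlinarith
  refine ⟨xb + t • (p - xb), ?_, ?_, ?_⟩
  · apply IsAligned.mem_bisector_of_inner (x := xb)
    rw [add_sub_cancel_left, inner_smul_left, hP]
    simp only [conj_trivial, ht]
    field_simp [hneg.ne]
    rfl
  · rw [add_sub_cancel_left, norm_smul, Real.norm_of_nonneg ht0]
    exact mul_le_of_le_one_left (norm_nonneg _) ht1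
  · rcases eq_or_lt_of_le ht0 with h0 | h0
    · left; rw [← h0]; simp
    · right
      have h1 := h.value_left p q hpq hp t ht0 ht1
      have h2 : 0 < c * t ^ 2 * ‖q - p‖ ^ 2 := by have := h.c_pos; positivity
      linarith

/-- The bisector of an aligned pair contains the saddle point or a point of lower value. -/
lemma exists_crossing (h : IsGoodRadius f xb e c C ε r) {p q : E n}
    (hpq : IsAligned e ε xb p q) (hp : p ∈ Metric.ball xb r) (hq : q ∈ Metric.ball xb r) :
    ∃ w ∈ AffineSubspace.perpBisector p q, ‖w - xb‖ ≤ max ‖p - xb‖ ‖q - xb‖ ∧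
      (w = xb ∨ f w < f xb) := by
  rcases le_total ⟪(p - xb) + (q - xb), q - p⟫ 0 with hσ | hσ
  · obtain ⟨w, hw, hwn, hwf⟩ := h.exists_crossing_of_nonpos hpq hp hσ
    exact ⟨w, hw, hwn.trans (le_max_left _ _), hwf⟩
  · have hσ' : ⟪(q - xb) + (p - xb), p - q⟫ ≤ 0 := by
      rw [← neg_sub q p, inner_neg_right, add_comm]; linarith
    obtain ⟨w, hw, hwn, hwf⟩ := h.exists_crossing_of_nonpos hpq.symm hq hσ'
    rw [AffineSubspace.perpBisector_comm] at hw
    exact ⟨w, hw, hwn.trans (le_max_right _ _), hwf⟩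

/-- Points on different sides of the saddle point are not joined below the critical value. -/
lemma not_joinedIn (h : IsGoodRadius f xb e c C ε r) {p q : E n} {l : ℝ}
    (hpq : ⟪e, p - xb⟫ * ⟪e, q - xb⟫ < 0) (hl : l < f xb) :
    ¬ JoinedIn ({w | f w ≤ l} ∩ Metric.ball xb r) p q := by
  intro hj
  set γ := hj.somePath with hγ
  have hcont : Continuous fun t : unitInterval => ⟪e, γ t - xb⟫ := by fun_prop
  have hzero : (0 : ℝ) ∈ Set.range fun t : unitInterval => ⟪e, γ t - xb⟫ := by
    rcases mul_neg_iff.mp hpq with ⟨h1, h2⟩ | ⟨h1, h2⟩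
    · exact mem_range_of_exists_le_of_exists_ge hcont ⟨1, by simpa using h2.le⟩
        ⟨0, by simpa using h1.le⟩
    · exact mem_range_of_exists_le_of_exists_ge hcont ⟨0, by simpa using h1.le⟩
        ⟨1, by simpa using h2.le⟩
  obtain ⟨t, ht⟩ := hzero
  have hmem := hj.somePath_mem t
  exact absurd (h.le_of_inner_eq_zero _ hmem.2 ht) (not_le.mpr (hmem.1.trans_lt hl))

/-- The closest pair of a starting pair is aligned, and the minimizer on its bisector lies between
the level of the pair and the critical level. -/
theorem closest_minimizer (h : IsGoodRadius f xb e c C ε r) {x y p q z : E n}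
    (hcl : IsClosestPair f (Metric.ball xb r) x y p q)
    (hmin : IsBisectorMinimizer f (Metric.ball xb r) p q z) (hpq : p ≠ q) (hx : f x < f xb) :
    ‖z - xb‖ ≤ 2 * ε * ‖q - p‖ ∧ f x < f z ∧ f z ≤ f xb ∧ (f z = f xb → z = xb) := by
  have hp := (pathComponentIn_subset hcl.left_mem).2
  have hq := (pathComponentIn_subset hcl.right_mem).2
  obtain ⟨hfp, hfq, hal⟩ := h.closest _ x y p q Metric.isOpen_ball hcl hpq hx hp hq
  have hN := hal.norm_pos
  have hz : ‖z - xb‖ ≤ 2 * ε * ‖q - p‖ := by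
    have := h.minimizer _ p q z (ε / 2) Metric.isOpen_ball hmin hal hmin.mem
      (hal.abs_inner_bisector_le hmin.mem_bisector)
    linarith
  obtain ⟨w, hw, hwn, hwf⟩ := h.exists_crossing hal hp hq
  have hwU : w ∈ Metric.ball xb r := by
    rw [mem_ball_iff_norm] at hp hq ⊢
    exact hwn.trans_lt (max_lt hp hq)
  have hzw := hmin.le w hw hwU
  refine ⟨hz, ?_, ?_, ?_⟩
  -- The pair is deeper than `c * ‖q - p‖ ^ 2`, the point `z` at most `C * (2 * ε * ‖q - p‖) ^ 2`
  -- deep; `eps_sq` compares the two.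
  · have h1 := h.value_left p q hal hp 1 zero_le_one le_rfl
    have h2 := (abs_le.mp (h.abs_sub_le z hmin.mem)).1
    have h3 : C * ‖z - xb‖ ^ 2 ≤ C * (2 * ε * ‖q - p‖) ^ 2 := by
      have := h.C_pos; gcongr
    have h4 : C * (2 * ε * ‖q - p‖) ^ 2 < c * ‖q - p‖ ^ 2 := by
      have := mul_lt_mul_of_pos_right h.eps_sq (sq_pos_of_pos hN)
      linarith
    rw [one_smul, add_sub_cancel, hfp] at h1
    linarith
  · rcases hwf with h1 | h1
    · rw [← h1]; exact hzw
    · linarith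
  · intro hzf
    have hwx : w = xb := hwf.resolve_right (by rw [← hzf]; exact not_lt.mpr hzw)
    rw [hwx] at hw
    have h1 := IsAligned.inner_bisector (x := xb) hw
    rw [sub_self, inner_zero_left] at h1
    -- The bisector passes through `xb` itself here, so the estimate holds with `δ = 0` and yields
    -- `z = xb`.
    have h2 := h.minimizer _ p q z 0 Metric.isOpen_ball hmin hal hmin.mem (by
      rw [IsAligned.inner_bisector (x := xb) hmin.mem_bisector, ← h1]; simp)
    simpa [sub_eq_zero] using h2

lemma closest_ne {U : Set (E n)} {d : ℝ} {x y p q : E n}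
    (hs : IsStartingPair f U d x y) (hcl : IsClosestPair f U x y p q) : p ≠ q := by
  rintro rfl
  exact hs.not_joined (JoinedIn.trans hcl.left_mem hcl.right_mem.symm)

/-- One pass of the algorithm from a starting pair leads to a starting pair of higher value or to
the saddle point. -/
theorem step_outcome (h : IsGoodRadius f xb e c C ε r) {x y p q z x' y' : E n}
    (hs : IsStartingPair f (Metric.ball xb r) (f xb) x y)
    (hst : IsStep f (Metric.ball xb r) x y p q z x' y') :
    f x < f z ∧ f x' = f z ∧
      (IsStartingPair f (Metric.ball xb r) (f xb) x' y' ∨ (x' = xb ∧ y' = xb)) := by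
  obtain ⟨hcl, hmin, hx', hy'⟩ := hst
  have hpq := closest_ne hs hcl
  have hp := (pathComponentIn_subset hcl.left_mem).2
  have hq := (pathComponentIn_subset hcl.right_mem).2
  obtain ⟨hfp, hfq, hal⟩ := h.closest _ x y p q Metric.isOpen_ball hcl hpq hs.value_lt hp hq
  obtain ⟨hz, hxz, hzle, hzeq⟩ := h.closest_minimizer hcl hmin hpq hs.value_lt
  have hconv := convex_ball xb r
  have hpz : segment ℝ p z ⊆ Metric.ball xb r := hconv.segment_subset hp hmin.mem
  have hqz : segment ℝ q z ⊆ Metric.ball xb r := hconv.segment_subset hq hmin.mem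
  have hfx' : f x' = f z := hx'.eq_value (h.continuousOn.mono hpz) (by rwa [hfp])
  have hfy' : f y' = f z := hy'.eq_value (h.continuousOn.mono hqz) (by rwa [hfq])
  refine ⟨hxz, hfx', ?_⟩
  rcases eq_or_lt_of_le hzle with h0 | h0
  · right
    have hzx := hzeq h0
    subst hzx
    have hc := h.c_pos
    have hseg : ∀ X : E n, (∀ t : ℝ, 0 ≤ t → t ≤ 1 →
        f (z + t • (X - z)) - f z ≤ -c * t ^ 2 * ‖q - p‖ ^ 2) →
        ∀ w ∈ segment ℝ X z, f w ≤ f z := by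
      intro X hX w hw
      rw [segment_symm, segment_eq_image'] at hw
      obtain ⟨t, ht, rfl⟩ := hw
      have h1 := hX t ht.1 ht.2
      have h2 : 0 ≤ c * t ^ 2 * ‖q - p‖ ^ 2 := by positivity
      linarith
    exact ⟨hx'.eq_right (hseg p (h.value_left p q hal hp)),
      hy'.eq_right (hseg q fun t => h.value_right hal hq)⟩
  · left
    refine ⟨hpz hx'.mem, hqz hy'.mem, by rw [hfx', hfy'], by rwa [hfx'], ?_⟩
    -- With the segments from `p` to `x'` and from `q` to `y'`, such a path would join `p` to `q`
    -- below the critical level.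
    intro hj
    rw [hfx'] at hj
    have j1 : JoinedIn ({w | f w ≤ f z} ∩ Metric.ball xb r) p x' :=
      JoinedIn.of_segment_subset fun w hw =>
        ⟨hx'.le w hw, hpz (segment_subset_segment_left hx'.mem hw)⟩
    have j2 : JoinedIn ({w | f w ≤ f z} ∩ Metric.ball xb r) q y' :=
      JoinedIn.of_segment_subset fun w hw =>
        ⟨hy'.le w hw, hqz (segment_subset_segment_left hy'.mem hw)⟩
    exact h.not_joinedIn (hal.inner_mul_inner_neg h.norm_e h.eps_le) h0
      ((j1.trans hj).trans j2.symm)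

end IsGoodRadius

end Step

/-! ### The double cone around the negative direction -/

section Cone

variable {n : ℕ}

/-- The behaviour of `f` in the ball of radius `r` around the saddle point `x`, with respect to the
double cone `‖perp e X‖ ≤ k * |⟪e, X⟫|` in direction `e`. -/
structure IsConeRadius (f : E n → ℝ) (x e : E n) (c k κ r : ℝ) : Prop where
  c_pos : 0 < c
  k_pos : 0 < k
  k_le : k ≤ 1
  κ_pos : 0 < κ
  κ_le : κ ≤ 1
  shrink : ∀ (X : E n) (s : ℝ), x + X ∈ Metric.ball x r → 0 ≤ s → s ≤ 1 →
    k * |⟪e, X⟫| ≤ s * ‖perp e X‖ → f (x + (⟪e, X⟫ • e + s • perp e X)) ≤ f (x + X)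
  radial : ∀ (X : E n) (τ : ℝ), ‖perp e X‖ ≤ k * |⟪e, X⟫| → 1 ≤ τ →
    x + τ • X ∈ Metric.ball x r → f (x + τ • X) ≤ f (x + X)
  value_le : ∀ X : E n, ‖perp e X‖ ≤ k * |⟪e, X⟫| → x + X ∈ Metric.ball x r →
    f (x + X) - f x ≤ -c * ‖X‖ ^ 2
  le_abs_inner : ∀ w ∈ Metric.ball x r, f w < f x → κ * ‖w - x‖ ≤ |⟪e, w - x⟫|

lemma IsConeRadius.mono {f : E n → ℝ} {x e : E n} {c k κ r s : ℝ}
    (h : IsConeRadius f x e c k κ r) (hsr : s ≤ r) : IsConeRadius f x e c k κ s := by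
  have hsub : Metric.ball x s ⊆ Metric.ball x r := Metric.ball_subset_ball hsr
  exact ⟨h.c_pos, h.k_pos, h.k_le, h.κ_pos, h.κ_le, fun X t h1 => h.shrink X t (hsub h1),
    fun X τ h1 h2 h3 => h.radial X τ h1 h2 (hsub h3), fun X h1 h2 => h.value_le X h1 (hsub h2),
    fun w hw => h.le_abs_inner w (hsub hw)⟩

lemma IsSaddleForm.inner_map_le_of_mem_cone {H : E n →L[ℝ] E n} {e : E n} {a b k : ℝ}
    (h : IsSaddleForm H e a b) (hk0 : 0 ≤ k) (hk1 : k ≤ 1) (hk : ‖H‖ * k ^ 2 ≤ a / 2) {X : E n}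
    (hX : ‖perp e X‖ ≤ k * |⟪e, X⟫|) : ⟪H X, X⟫ ≤ -(a / 4) * ‖X‖ ^ 2 := by
  have ha := h.a_pos
  have h1 := h.inner_map_le X
  have h2 := norm_sq_eq h.norm_eq X
  have h3 : ‖perp e X‖ ^ 2 ≤ k ^ 2 * ⟪e, X⟫ ^ 2 := by
    rw [← sq_abs ⟪e, X⟫, ← mul_pow]; gcongr
  have h4 : ‖H‖ * ‖perp e X‖ ^ 2 ≤ a / 2 * ⟪e, X⟫ ^ 2 := by
    calc ‖H‖ * ‖perp e X‖ ^ 2 ≤ ‖H‖ * (k ^ 2 * ⟪e, X⟫ ^ 2) := by gcongr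
      _ = ‖H‖ * k ^ 2 * ⟪e, X⟫ ^ 2 := by ring
      _ ≤ _ := by gcongr
  have h5 : k ^ 2 * ⟪e, X⟫ ^ 2 ≤ 1 * ⟪e, X⟫ ^ 2 := by
    gcongr; exact pow_le_one₀ hk0 hk1
  nlinarith

/-- The two monotonicity properties come from the sign of the derivative along a line. Outside the
cone `|⟪e, X⟫|` is at most `1 / k` times the orthogonal part, so `η * (1 + 1 / k) ≤ b` lets
coercivity beat the error; inside it, `k` is small enough for the form to be at most `-(a / 4) * ‖X‖
^ 2`. The value of `κ` solves the inequality that `f w < f x` imposes on the two components, using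
`b ≤ a`. -/
theorem exists_isConeRadius {f : E n → ℝ} {x : E n} (hf : ContDiffAt ℝ 2 f x)
    (hx : fderiv ℝ f x = 0) {e : E n} {a b : ℝ} (h : IsSaddleForm (hessianOp f x) e a b) :
    ∃ c k κ r : ℝ, 0 < r ∧ IsConeRadius f x e c k κ r := by
  have ha := h.a_pos
  have hb := h.pos
  set H := hessianOp f x with hH
  set k := min 1 (Real.sqrt (a / (2 * (‖H‖ + 1)))) with hkdef
  have hk : 0 < k := lt_min one_pos (Real.sqrt_pos.mpr (by positivity))
  have hk1 : k ≤ 1 := min_le_left _ _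
  have hHk : ‖H‖ * k ^ 2 ≤ a / 2 := by
    have h1 : k ^ 2 ≤ a / (2 * (‖H‖ + 1)) := by
      rw [← Real.sq_sqrt (by positivity : 0 ≤ a / (2 * (‖H‖ + 1)))]
      have : k ≤ Real.sqrt (a / (2 * (‖H‖ + 1))) := min_le_right _ _
      gcongr
    rw [le_div_iff₀ (by positivity)] at h1
    nlinarith [sq_nonneg k]
  set κ := Real.sqrt (b / (b + 3 * a)) with hκdef
  have hκsq : κ ^ 2 = b / (b + 3 * a) := Real.sq_sqrt (by positivity)
  have hκ : 0 < κ := Real.sqrt_pos.mpr (by positivity)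
  have hκ1 : κ ≤ 1 := by
    rw [hκdef, Real.sqrt_le_left zero_le_one, one_pow, div_le_one (by positivity)]; linarith
  set η := min (a / 16) (min (b / 4) (b / (1 + 1 / k))) with hηdef
  have hη : 0 < η := by positivity
  have hηa : η ≤ a / 16 := min_le_left _ _
  have hηb : η ≤ b / 4 := (min_le_right _ _).trans (min_le_left _ _)
  have hηk : η * (1 + 1 / k) ≤ b := by
    rw [← le_div_iff₀ (by positivity)]
    exact (min_le_right _ _).trans (min_le_right _ _)
  obtain ⟨r, hr, happ⟩ := exists_isQuadraticApprox hf hx hη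
  refine ⟨a / 16, k, κ, r, hr, by positivity, hk, hk1, hκ, hκ1, ?_, ?_, ?_, ?_⟩
  · intro X s hX hs0 hs1 hs
    set u := ⟪e, X⟫ with hu
    set W := perp e X with hW
    have heW : ⟪e, W⟫ = 0 := inner_perp h.norm_eq X
    have hXeq : X = u • e + W := eq_add_perp e X
    have hmem : ∀ t ∈ Set.Icc s 1, (x + u • e) + t • W ∈ Metric.ball x r := by
      intro t ht
      rw [mem_ball_iff_norm] at hX ⊢
      refine lt_of_le_of_lt ?_ hX
      rw [add_sub_cancel_left, show x + u • e + t • W - x = u • e + t • W by abel, hXeq]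
      refine le_of_sq_le_sq ?_ (norm_nonneg _)
      rw [norm_add_sq_real, norm_add_sq_real, inner_smul_left, inner_smul_right, inner_smul_left,
        heW, norm_smul t W, Real.norm_of_nonneg (hs0.trans ht.1), mul_pow]
      have : t ^ 2 ≤ 1 := pow_le_one₀ (hs0.trans ht.1) ht.2
      have := mul_le_mul_of_nonneg_right this (sq_nonneg ‖W‖)
      linarith
    have hder : ∀ t ∈ Set.Icc s 1, HasDerivAt (fun t : ℝ => f ((x + u • e) + t • W))
        ⟪∇ f ((x + u • e) + t • W), W⟫ t := fun t ht =>
      hasDerivAt_comp_line (happ _ (hmem t ht)).1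
    have hmono : MonotoneOn (fun t : ℝ => f ((x + u • e) + t • W)) (Set.Icc s 1) := by
      refine monotoneOn_of_hasDerivWithinAt_nonneg (convex_Icc s 1)
        (fun t ht => (hder t ht).continuousAt.continuousWithinAt)
        (fun t ht => (hder t (interior_subset ht)).hasDerivWithinAt) ?_
      intro t ht
      have ht' := interior_subset ht
      have ht0 : 0 ≤ t := hs0.trans ht'.1
      have h1 := (happ _ (hmem t ht')).2.1
      rw [show x + u • e + t • W - x = u • e + t • W by abel] at h1
      set Y := u • e + t • W with hY
      set g := ∇ f ((x + u • e) + t • W) with hg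
      have h2 : ⟪H Y, W⟫ = t * ⟪H W, W⟫ := by
        rw [hY, map_add, map_smul, map_smul, h.map_eq, inner_add_left, inner_smul_left,
          inner_smul_left, inner_neg_left, inner_smul_left, heW]
        simp
      have h3 := h.coercive W heW
      have h4 : |⟪g - H Y, W⟫| ≤ η * ‖Y‖ * ‖W‖ :=
        (abs_real_inner_le_norm _ _).trans (by gcongr)
      have h5 : ‖Y‖ ≤ (1 + 1 / k) * (t * ‖W‖) := by
        have h6 : ‖Y‖ ≤ |u| + t * ‖W‖ := by
          refine (norm_add_le _ _).trans ?_
          rw [norm_smul, norm_smul, h.norm_eq, mul_one, Real.norm_eq_abs,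
            Real.norm_of_nonneg ht0]
        have h7 : |u| ≤ 1 / k * (t * ‖W‖) := by
          rw [div_mul_eq_mul_div, le_div_iff₀ hk]
          have := mul_le_mul_of_nonneg_right ht'.1 (norm_nonneg W)
          linarith
        linarith
      have h8 : η * ‖Y‖ * ‖W‖ ≤ b * (t * ‖W‖ ^ 2) := by
        calc η * ‖Y‖ * ‖W‖ ≤ η * ((1 + 1 / k) * (t * ‖W‖)) * ‖W‖ := by gcongr
          _ = η * (1 + 1 / k) * (t * ‖W‖ ^ 2) := by ring
          _ ≤ _ := by gcongr
      have h9 : ⟪g, W⟫ = ⟪g - H Y, W⟫ + t * ⟪H W, W⟫ := by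
        rw [← h2, ← inner_add_left, sub_add_cancel]
      have h10 := mul_le_mul_of_nonneg_left h3 ht0
      have h11 := (abs_le.mp h4).1
      rw [h9]
      linarith
    have := hmono (Set.left_mem_Icc.mpr hs1) (Set.right_mem_Icc.mpr hs1) hs1
    simp only [one_smul, add_assoc] at this
    rwa [← hXeq] at this
  · intro X τ hX hτ hmem
    have hq := h.inner_map_le_of_mem_cone hk.le hk1 hHk hX
    have hmem' : ∀ t ∈ Set.Icc 1 τ, x + t • X ∈ Metric.ball x r := by
      intro t ht
      rw [mem_ball_iff_norm, add_sub_cancel_left, norm_smul] at hmem ⊢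
      rw [Real.norm_of_nonneg (by linarith)] at hmem
      rw [Real.norm_of_nonneg (by linarith [ht.1])]
      exact (mul_le_mul_of_nonneg_right ht.2 (norm_nonneg X)).trans_lt hmem
    have hder : ∀ t ∈ Set.Icc 1 τ, HasDerivAt (fun t : ℝ => f (x + t • X))
        ⟪∇ f (x + t • X), X⟫ t := fun t ht => hasDerivAt_comp_line (happ _ (hmem' t ht)).1
    have hanti : AntitoneOn (fun t : ℝ => f (x + t • X)) (Set.Icc 1 τ) := by
      refine antitoneOn_of_hasDerivWithinAt_nonpos (convex_Icc 1 τ)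
        (fun t ht => (hder t ht).continuousAt.continuousWithinAt)
        (fun t ht => (hder t (interior_subset ht)).hasDerivWithinAt) ?_
      intro t ht
      have ht' := interior_subset ht
      have ht0 : 0 ≤ t := zero_le_one.trans ht'.1
      have h1 := (happ _ (hmem' t ht')).2.1
      rw [add_sub_cancel_left] at h1
      set g := ∇ f (x + t • X) with hg
      have h2 : |⟪g - H (t • X), X⟫| ≤ η * ‖t • X‖ * ‖X‖ :=
        (abs_real_inner_le_norm _ _).trans (by gcongr)
      have h3 : ⟪g, X⟫ = ⟪g - H (t • X), X⟫ + t * ⟪H X, X⟫ := by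
        rw [inner_sub_left, map_smul, inner_smul_left]; simp
      rw [norm_smul, Real.norm_of_nonneg ht0] at h2
      have h4 := (abs_le.mp h2).2
      have h5 : η * (t * ‖X‖) * ‖X‖ ≤ a / 16 * (t * ‖X‖ ^ 2) := by
        calc η * (t * ‖X‖) * ‖X‖ = η * (t * ‖X‖ ^ 2) := by ring
          _ ≤ _ := by gcongr
      have h6 := mul_le_mul_of_nonneg_left hq ht0
      have h7 : 0 ≤ a * (t * ‖X‖ ^ 2) := by positivity
      rw [h3]
      linarith
    have := hanti (Set.left_mem_Icc.mpr hτ) (Set.right_mem_Icc.mpr hτ) hτ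
    simpa using this
  · intro X hX hmem
    have hq := h.inner_map_le_of_mem_cone hk.le hk1 hHk hX
    have h1 := (abs_le.mp (happ _ hmem).2.2).2
    rw [add_sub_cancel_left] at h1
    have h2 : η * ‖X‖ ^ 2 ≤ a / 16 * ‖X‖ ^ 2 := by gcongr
    linarith
  · intro w hw hlt
    have h1 := (abs_le.mp (happ w hw).2.2).1
    have h2 := h.le_inner_map (w - x)
    have h3 := norm_sq_eq h.norm_eq (w - x)
    have h4 : η * ‖w - x‖ ^ 2 ≤ b / 4 * ‖w - x‖ ^ 2 := by gcongr
    have h5 : κ ^ 2 * ‖w - x‖ ^ 2 ≤ ⟪e, w - x⟫ ^ 2 := by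
      rw [hκsq, div_mul_eq_mul_div, div_le_iff₀ (by positivity)]
      have := h.le
      nlinarith [sq_nonneg ⟪e, w - x⟫]
    rw [← mul_pow] at h5
    exact (le_abs_self _).trans (sq_le_sq.mp h5)

end Cone

/-! ### Components of sublevel sets and existence of the iterates -/

section Existence

variable {n : ℕ} {f : E n → ℝ} {xb e : E n} {c C ε c' k κ r l : ℝ}

namespace IsConeRadius

/-- Shrinking the component orthogonal to `e` leads into the cone. -/
lemma exists_joinedIn_cone (h : IsConeRadius f xb e c' k κ r) (he : ‖e‖ = 1) {X : E n}
    (hX : xb + X ∈ {w | f w ≤ l} ∩ Metric.ball xb r) :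
    ∃ Y : E n, ⟪e, Y⟫ = ⟪e, X⟫ ∧ ‖perp e Y‖ ≤ k * |⟪e, Y⟫| ∧
      JoinedIn ({w | f w ≤ l} ∩ Metric.ball xb r) (xb + X) (xb + Y) := by
  rcases le_or_gt ‖perp e X‖ (k * |⟪e, X⟫|) with h0 | h0
  · exact ⟨X, rfl, h0, JoinedIn.refl hX⟩
  set u := ⟪e, X⟫ with hu
  set W := perp e X with hW
  have heW : ⟪e, W⟫ = 0 := inner_perp he X
  have hku : 0 ≤ k * |u| := mul_nonneg h.k_pos.le (abs_nonneg u)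
  have hWpos : 0 < ‖W‖ := hku.trans_lt h0
  set s := k * |u| / ‖W‖ with hs
  have hs0 : 0 ≤ s := by positivity
  have hs1 : s ≤ 1 := div_le_one_of_le₀ h0.le hWpos.le
  have hsW : s * ‖W‖ = k * |u| := div_mul_cancel₀ _ hWpos.ne'
  have hpt : ∀ t, s ≤ t → t ≤ 1 →
      xb + (u • e + t • W) ∈ {w | f w ≤ l} ∩ Metric.ball xb r := by
    intro t hst ht1
    have ht0 := hs0.trans hst
    refine ⟨(h.shrink X t hX.2 ht0 ht1 ?_).trans hX.1, ?_⟩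
    · rw [← hu, ← hW, ← hsW]; gcongr
    · have hb := hX.2
      rw [mem_ball_iff_norm, add_sub_cancel_left] at hb ⊢
      refine lt_of_le_of_lt ?_ hb
      rw [eq_add_perp e X, ← hu, ← hW]
      refine le_of_sq_le_sq ?_ (norm_nonneg _)
      rw [norm_add_sq_real, norm_add_sq_real, inner_smul_left, inner_smul_right, inner_smul_left,
        heW, norm_smul t W, Real.norm_of_nonneg ht0, mul_pow]
      have := mul_le_mul_of_nonneg_right (pow_le_one₀ ht0 ht1 : t ^ 2 ≤ 1) (sq_nonneg ‖W‖)
      linarith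
  have hYu : ⟪e, u • e + s • W⟫ = u := by
    rw [inner_add_right, inner_smul_right, inner_smul_right, heW, real_inner_self_eq_norm_sq, he]
    simp
  refine ⟨u • e + s • W, hYu, ?_, JoinedIn.of_segment_subset ?_⟩
  · have : perp e (u • e + s • W) = s • W := by rw [perp, hYu]; abel
    rw [this, hYu, norm_smul, Real.norm_of_nonneg hs0, hsW]
  · rw [segment_eq_image']
    rintro _ ⟨τ, hτ, rfl⟩
    have h1 : xb + X + τ • (xb + (u • e + s • W) - (xb + X)) =
        xb + (u • e + (1 - τ * (1 - s)) • W) := by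
      have hXe : X = u • e + W := eq_add_perp e X
      rw [hXe]; module
    simp only [h1]
    have h2 : 0 ≤ τ * (1 - s) := mul_nonneg hτ.1 (by linarith)
    have h3 : τ * (1 - s) ≤ 1 - s := mul_le_of_le_one_left (by linarith) hτ.2
    exact hpt _ (by linarith) (by linarith)

/-- Moving away from the saddle point inside the cone leads to a point of norm at least `ρ`. -/
lemma exists_joinedIn_norm_ge (h : IsConeRadius f xb e c' k κ r) {ρ : ℝ} (hρ : ρ < r) {X : E n}
    (hX0 : X ≠ 0) (hcone : ‖perp e X‖ ≤ k * |⟪e, X⟫|)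
    (hX : xb + X ∈ {w | f w ≤ l} ∩ Metric.ball xb r) :
    ∃ τ : ℝ, 1 ≤ τ ∧ ρ ≤ ‖τ • X‖ ∧
      JoinedIn ({w | f w ≤ l} ∩ Metric.ball xb r) (xb + X) (xb + τ • X) := by
  rcases le_or_gt ρ ‖X‖ with h0 | h0
  · exact ⟨1, le_rfl, by rwa [one_smul], by rw [one_smul]; exact JoinedIn.refl hX⟩
  have hXp : 0 < ‖X‖ := norm_pos_iff.mpr hX0
  set τ := ρ / ‖X‖ with hτ
  have hτ1 : 1 ≤ τ := by rw [hτ, le_div_iff₀ hXp]; linarith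
  have hτX : τ * ‖X‖ = ρ := div_mul_cancel₀ _ hXp.ne'
  refine ⟨τ, hτ1, ?_, JoinedIn.of_segment_subset ?_⟩
  · rw [norm_smul, Real.norm_of_nonneg (by linarith), hτX]
  · rw [segment_eq_image']
    rintro _ ⟨s, hs, rfl⟩
    have h1 : xb + X + s • (xb + τ • X - (xb + X)) = xb + (1 + s * (τ - 1)) • X := by module
    simp only [h1]
    have h2 : 0 ≤ s * (τ - 1) := mul_nonneg hs.1 (by linarith)
    have h3 : s * (τ - 1) ≤ τ - 1 := mul_le_of_le_one_left (by linarith) hs.2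
    have h4 : xb + (1 + s * (τ - 1)) • X ∈ Metric.ball xb r := by
      rw [mem_ball_iff_norm, add_sub_cancel_left, norm_smul, Real.norm_of_nonneg (by linarith)]
      calc (1 + s * (τ - 1)) * ‖X‖ ≤ τ * ‖X‖ := by gcongr; linarith
        _ < r := by rw [hτX]; exact hρ
    exact ⟨(h.radial X _ hcone (by linarith) h4).trans hX.1, h4⟩

/-- Points of the double cone on the same side and away from the saddle point are joined. -/
lemma joinedIn_of_cone (h : IsConeRadius f xb e c' k κ r) (he : ‖e‖ = 1) {ρ : ℝ} (hρ : 0 ≤ ρ)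
    (hl : f xb - c' * (ρ / 2) ^ 2 ≤ l) {X Y : E n} (hXY : 0 < ⟪e, X⟫ * ⟪e, Y⟫)
    (hX : ‖perp e X‖ ≤ k * |⟪e, X⟫|) (hY : ‖perp e Y‖ ≤ k * |⟪e, Y⟫|)
    (hXρ : ρ ≤ ‖X‖) (hYρ : ρ ≤ ‖Y‖)
    (hXr : xb + X ∈ Metric.ball xb r) (hYr : xb + Y ∈ Metric.ball xb r) :
    JoinedIn ({w | f w ≤ l} ∩ Metric.ball xb r) (xb + X) (xb + Y) := by
  refine JoinedIn.of_segment_subset ?_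
  rintro _ ⟨s, t, hs, ht, hst, rfl⟩
  have h1 : s • (xb + X) + t • (xb + Y) = xb + (s • X + t • Y) := by
    have : s • xb + t • xb = xb := by rw [← add_smul, hst, one_smul]
    calc _ = (s • xb + t • xb) + (s • X + t • Y) := by module
      _ = _ := by rw [this]
  have hball : xb + (s • X + t • Y) ∈ Metric.ball xb r := by
    rw [← h1]; exact convex_ball xb r hXr hYr hs ht hst
  rw [h1]
  -- On one side of the hyperplane the absolute value is linear, so half of the double cone is
  -- convex and the segment stays at distance at least `ρ / 2` from the saddle.
  have hu : |⟪e, s • X + t • Y⟫| = s * |⟪e, X⟫| + t * |⟪e, Y⟫| := by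
    rw [inner_add_right, inner_smul_right, inner_smul_right]
    rcases mul_pos_iff.mp hXY with ⟨h2, h3⟩ | ⟨h2, h3⟩
    · rw [abs_of_pos h2, abs_of_pos h3, abs_of_nonneg (by positivity)]
    · have h4 := mul_nonpos_of_nonneg_of_nonpos hs h2.le
      have h5 := mul_nonpos_of_nonneg_of_nonpos ht h3.le
      rw [abs_of_neg h2, abs_of_neg h3, abs_of_nonpos (by linarith)]; ring
  have hhalf : ∀ Z : E n, ‖perp e Z‖ ≤ k * |⟪e, Z⟫| → ρ ≤ ‖Z‖ → ρ / 2 ≤ |⟪e, Z⟫| := by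
    intro Z hZ hZρ
    have h2 := norm_le_abs_add_perp he Z
    have h3 : k * |⟪e, Z⟫| ≤ 1 * |⟪e, Z⟫| := by gcongr; exact h.k_le
    linarith
  have hcone : ‖perp e (s • X + t • Y)‖ ≤ k * |⟪e, s • X + t • Y⟫| := by
    rw [hu, perp_add, perp_smul, perp_smul]
    refine (norm_add_le _ _).trans ?_
    rw [norm_smul, norm_smul, Real.norm_of_nonneg hs, Real.norm_of_nonneg ht]
    have h2 := mul_le_mul_of_nonneg_left hX hs
    have h3 := mul_le_mul_of_nonneg_left hY ht
    linarith
  have hnorm : ρ / 2 ≤ ‖s • X + t • Y‖ := by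
    refine le_trans ?_ (abs_inner_unit_le he _)
    rw [hu]
    have h2 := mul_le_mul_of_nonneg_left (hhalf X hX hXρ) hs
    have h3 := mul_le_mul_of_nonneg_left (hhalf Y hY hYρ) ht
    calc ρ / 2 = s * (ρ / 2) + t * (ρ / 2) := by rw [← add_mul, hst, one_mul]
      _ ≤ _ := by linarith
  refine ⟨?_, hball⟩
  have h2 := h.value_le _ hcone hball
  have h3 : c' * (ρ / 2) ^ 2 ≤ c' * ‖s • X + t • Y‖ ^ 2 := by
    have := h.c_pos; gcongr
  change f _ ≤ l
  linarith

/-- Points of a sublevel set near the critical level on the same side of the saddle point are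
joined. -/
theorem joinedIn_of_same_side (h : IsConeRadius f xb e c' k κ r) (he : ‖e‖ = 1) (hr : 0 < r)
    (hl : f xb - c' * (r / 4) ^ 2 ≤ l) {v w : E n}
    (hv : v ∈ {w | f w ≤ l} ∩ Metric.ball xb r) (hw : w ∈ {w | f w ≤ l} ∩ Metric.ball xb r)
    (hvw : 0 < ⟪e, v - xb⟫ * ⟪e, w - xb⟫) :
    JoinedIn ({w | f w ≤ l} ∩ Metric.ball xb r) v w := by
  have key : ∀ y ∈ {w | f w ≤ l} ∩ Metric.ball xb r, ⟪e, y - xb⟫ ≠ 0 →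
      ∃ (Z : E n) (τ : ℝ), 0 < τ ∧ ⟪e, Z⟫ = τ * ⟪e, y - xb⟫ ∧ ‖perp e Z‖ ≤ k * |⟪e, Z⟫| ∧
        r / 2 ≤ ‖Z‖ ∧ JoinedIn ({w | f w ≤ l} ∩ Metric.ball xb r) y (xb + Z) := by
    intro y hy hy0
    obtain ⟨Y, hYu, hYc, hYj⟩ := h.exists_joinedIn_cone he (X := y - xb)
      (by rwa [add_sub_cancel])
    rw [add_sub_cancel] at hYj
    have hY0 : Y ≠ 0 := by
      rintro rfl; rw [inner_zero_right] at hYu; exact hy0 hYu.symm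
    obtain ⟨τ, hτ, hτρ, hτj⟩ := h.exists_joinedIn_norm_ge (half_lt_self hr) hY0 hYc
      hYj.target_mem
    have hτ0 : 0 < τ := by linarith
    refine ⟨τ • Y, τ, hτ0, by rw [inner_smul_right, hYu], ?_, hτρ, hYj.trans hτj⟩
    rw [perp_smul, inner_smul_right, norm_smul, abs_mul, Real.norm_of_nonneg hτ0.le,
      abs_of_pos hτ0]
    have := mul_le_mul_of_nonneg_left hYc hτ0.le
    linarith
  obtain ⟨X, s, hs, hXu, hXc, hXρ, hXj⟩ := key v hv (left_ne_zero_of_mul hvw.ne')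
  obtain ⟨Y, t, ht, hYu, hYc, hYρ, hYj⟩ := key w hw (right_ne_zero_of_mul hvw.ne')
  have hXY : 0 < ⟪e, X⟫ * ⟪e, Y⟫ := by
    rw [hXu, hYu]
    have := mul_pos (mul_pos hs ht) hvw
    linarith
  refine (hXj.trans ?_).trans hYj.symm
  exact h.joinedIn_of_cone he (half_pos hr).le (by convert hl using 4; ring) hXY hXc hYc hXρ hYρ
    hXj.target_mem.2 hYj.target_mem.2

end IsConeRadius

/-- Near the critical level, the path components of a sublevel set are its two sides. -/
theorem mem_levelComponent_iff (hg : IsGoodRadius f xb e c C ε r)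
    (h : IsConeRadius f xb e c' k κ r) (hl : f xb - c' * (r / 4) ^ 2 ≤ l) (hl' : l < f xb)
    {x w : E n} (hx : x ∈ {w | f w ≤ l} ∩ Metric.ball xb r) :
    w ∈ levelComponent f (Metric.ball xb r) l x ↔
      w ∈ {w | f w ≤ l} ∩ Metric.ball xb r ∧ 0 < ⟪e, x - xb⟫ * ⟪e, w - xb⟫ := by
  constructor
  · intro hw
    refine ⟨pathComponentIn_subset hw, ?_⟩
    by_contra! hle
    rcases lt_or_eq_of_le hle with hlt | heq
    · exact hg.not_joinedIn hlt hl' hw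
    · rcases mul_eq_zero.mp heq with h0 | h0
      · exact absurd (hg.le_of_inner_eq_zero x hx.2 h0) (not_le.mpr (hx.1.trans_lt hl'))
      · have hw' := pathComponentIn_subset hw
        exact absurd (hg.le_of_inner_eq_zero w hw'.2 h0) (not_le.mpr (hw'.1.trans_lt hl'))
  · rintro ⟨hw, hpos⟩
    exact h.joinedIn_of_same_side hg.norm_e hg.pos hl hx hw hpos

lemma inner_mul_inner_neg_of_startingPair (hg : IsGoodRadius f xb e c C ε r)
    (h : IsConeRadius f xb e c' k κ r) {x y : E n}
    (hs : IsStartingPair f (Metric.ball xb r) (f xb) x y)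
    (hl : f xb - c' * (r / 4) ^ 2 ≤ f x) : ⟪e, x - xb⟫ * ⟪e, y - xb⟫ < 0 := by
  have hx : x ∈ {w | f w ≤ f x} ∩ Metric.ball xb r := ⟨le_refl (f x), hs.left_mem⟩
  have hy : y ∈ {w | f w ≤ f x} ∩ Metric.ball xb r := ⟨hs.value_eq.ge, hs.right_mem⟩
  by_contra! hge
  rcases lt_or_eq_of_le hge with hlt | heq
  · exact hs.not_joined (h.joinedIn_of_same_side hg.norm_e hg.pos hl hx hy hlt)
  · rcases mul_eq_zero.mp heq.symm with h0 | h0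
    · exact absurd (hg.le_of_inner_eq_zero x hx.2 h0) (not_le.mpr hs.value_lt)
    · exact absurd (hg.le_of_inner_eq_zero y hy.2 h0)
        (not_le.mpr (hs.value_eq ▸ hs.value_lt))

/-- Near the critical level, each side of the sublevel set contains a point at distance `t` from
the saddle point. -/
lemma exists_competitor (hg : IsGoodRadius f xb e c C ε r)
    (h : IsConeRadius f xb e c' k κ r) {t u : ℝ} (ht : 0 < t) (htr : t < r) (hu : u ≠ 0)
    (hl : f xb - c' * t ^ 2 ≤ l) :
    ∃ w ∈ {w | f w ≤ l} ∩ Metric.ball xb r, 0 < u * ⟪e, w - xb⟫ ∧ ‖w - xb‖ = t := by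
  have key : ∀ s : ℝ, |s| = t → xb + s • e ∈ {w | f w ≤ l} ∩ Metric.ball xb r ∧
      ⟪e, xb + s • e - xb⟫ = s ∧ ‖xb + s • e - xb‖ = t := by
    intro s hs
    have h1 : ⟪e, s • e⟫ = s := by
      rw [inner_smul_right, real_inner_self_eq_norm_sq, hg.norm_e]; simp
    have h2 : ‖s • e‖ = t := by rw [norm_smul, hg.norm_e, mul_one, Real.norm_eq_abs, hs]
    have h3 : xb + s • e ∈ Metric.ball xb r := by
      rw [mem_ball_iff_norm, add_sub_cancel_left, h2]; exact htr
    rw [add_sub_cancel_left]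
    refine ⟨⟨?_, h3⟩, h1, h2⟩
    have h4 := h.value_le (s • e) (by
      rw [perp, h1, sub_self, norm_zero]; exact mul_nonneg h.k_pos.le (abs_nonneg _)) h3
    rw [h2] at h4
    change f _ ≤ l
    linarith
  rcases lt_or_gt_of_ne hu with h0 | h0
  · obtain ⟨h1, h2, h3⟩ := key (-t) (by rw [abs_neg, abs_of_pos ht])
    exact ⟨_, h1, by rw [h2]; nlinarith, h3⟩
  · obtain ⟨h1, h2, h3⟩ := key t (abs_of_pos ht)
    exact ⟨_, h1, by rw [h2]; positivity, h3⟩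

/-- Near the critical level, closest pairs exist. -/
theorem exists_isClosestPair (hg : IsGoodRadius f xb e c C ε r)
    (h : IsConeRadius f xb e c' k κ r) {x y : E n}
    (hs : IsStartingPair f (Metric.ball xb r) (f xb) x y)
    (hl : f xb - c' * (κ * r / 4) ^ 2 < f x) :
    ∃ p q, IsClosestPair f (Metric.ball xb r) x y p q ∧ ‖p - xb‖ ≤ r / 2 ∧ ‖q - xb‖ ≤ r / 2 ∧
      ‖q - p‖ ≤ κ * r / 2 := by
  have hr := hg.pos
  have hc' := h.c_pos
  have hκ := h.κ_pos
  have hκr : κ * r ≤ r := mul_le_of_le_one_left hr.le h.κ_le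
  have hl4 : f xb - c' * (r / 4) ^ 2 ≤ f x := by
    have : c' * (κ * r / 4) ^ 2 ≤ c' * (r / 4) ^ 2 := by gcongr
    linarith
  have hneg := inner_mul_inner_neg_of_startingPair hg h hs hl4
  have hx : x ∈ {w | f w ≤ f x} ∩ Metric.ball xb r := ⟨le_refl (f x), hs.left_mem⟩
  have hy : y ∈ {w | f w ≤ f x} ∩ Metric.ball xb r := ⟨hs.value_eq.ge, hs.right_mem⟩
  -- Two competitors at distance `t` from `xb` are at most `κ * r / 2` apart, which is the lower
  -- bound `hfar` for any pair with a point outside the half ball.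
  set t := κ * r / 4 with ht
  have htp : 0 < t := by positivity
  have hsub : Metric.closedBall xb (r / 2) ⊆ Metric.ball xb r :=
    Metric.closedBall_subset_ball (half_lt_self hr)
  -- The weak inequality makes `A v` closed. It adds no points to the component, since `f` is at
  -- least `f xb` on the hyperplane.
  set A : E n → Set (E n) := fun v =>
    Metric.closedBall xb (r / 2) ∩ {w | f w ≤ f x ∧ 0 ≤ ⟪e, v - xb⟫ * ⟪e, w - xb⟫} with hA
  have hAc : ∀ v, IsCompact (A v) := by
    intro v
    refine (isCompact_closedBall xb (r / 2)).of_isClosed_subset ?_ Set.inter_subset_left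
    have h1 : IsClosed (Metric.closedBall xb (r / 2) ∩ f ⁻¹' Set.Iic (f x)) :=
      (hg.continuousOn.mono hsub).preimage_isClosed_of_isClosed Metric.isClosed_closedBall
        isClosed_Iic
    have h2 : IsClosed {w : E n | 0 ≤ ⟪e, v - xb⟫ * ⟪e, w - xb⟫} :=
      isClosed_le continuous_const (by fun_prop)
    have h3 := h1.inter h2
    rwa [Set.inter_assoc] at h3
  have hmemA : ∀ v ∈ {w | f w ≤ f x} ∩ Metric.ball xb r, ∀ w ∈ A v,
      w ∈ levelComponent f (Metric.ball xb r) (f x) v := by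
    intro v hv w hw
    refine (mem_levelComponent_iff hg h hl4 hs.value_lt hv).mpr ⟨⟨hw.2.1, hsub hw.1⟩, ?_⟩
    refine lt_of_le_of_ne hw.2.2 fun h0 => ?_
    rcases mul_eq_zero.mp h0.symm with h1 | h1
    · exact absurd (hg.le_of_inner_eq_zero v hv.2 h1) (not_le.mpr (hv.1.trans_lt hs.value_lt))
    · exact absurd (hg.le_of_inner_eq_zero w (hsub hw.1) h1)
        (not_le.mpr (hw.2.1.trans_lt hs.value_lt))
  have hcomp : ∀ v, ⟪e, v - xb⟫ ≠ 0 → ∃ w ∈ A v, ‖w - xb‖ = t := by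
    intro v hv
    obtain ⟨w, hw, hpos, hwt⟩ := exists_competitor hg h htp (by linarith) hv hl.le
    refine ⟨w, ⟨?_, hw.1, hpos.le⟩, hwt⟩
    rw [mem_closedBall_iff_norm, hwt]; linarith
  obtain ⟨w₁, hw₁, hw₁t⟩ := hcomp x (left_ne_zero_of_mul hneg.ne)
  obtain ⟨w₂, hw₂, hw₂t⟩ := hcomp y (right_ne_zero_of_mul hneg.ne)
  obtain ⟨p, hp, q, hq, hmin⟩ : ∃ p ∈ A x, ∃ q ∈ A y, ∀ v ∈ A x, ∀ w ∈ A y,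
      dist p q ≤ dist v w := by
    have hc : ContinuousOn (fun v : E n × E n => dist v.1 v.2) (A x ×ˢ A y) := by fun_prop
    obtain ⟨m, hm, hmin⟩ :=
      ((hAc x).prod (hAc y)).exists_isMinOn ⟨(w₁, w₂), Set.mk_mem_prod hw₁ hw₂⟩ hc
    exact ⟨m.1, hm.1, m.2, hm.2, fun v hv w hw =>
      isMinOn_iff.mp hmin (v, w) (Set.mk_mem_prod hv hw)⟩
  have hpq : dist p q ≤ κ * r / 2 := by
    have h1 : dist p q ≤ dist w₁ w₂ := hmin w₁ hw₁ w₂ hw₂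
    have h2 := dist_triangle_right w₁ w₂ xb
    rw [dist_eq_norm w₁ xb, dist_eq_norm w₂ xb, hw₁t, hw₂t] at h2
    linarith
  have hfar : ∀ p' q' : E n, p' ∈ levelComponent f (Metric.ball xb r) (f x) x →
      q' ∈ levelComponent f (Metric.ball xb r) (f x) y →
      (r / 2 < ‖p' - xb‖ ∨ r / 2 < ‖q' - xb‖) → κ * r / 2 ≤ dist p' q' := by
    intro p' q' hp' hq' hor
    obtain ⟨hp1, hp2⟩ := (mem_levelComponent_iff hg h hl4 hs.value_lt hx).mp hp'
    obtain ⟨hq1, hq2⟩ := (mem_levelComponent_iff hg h hl4 hs.value_lt hy).mp hq'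
    have h1 := h.le_abs_inner p' hp1.2 (hp1.1.trans_lt hs.value_lt)
    have h2 := h.le_abs_inner q' hq1.2 (hq1.1.trans_lt hs.value_lt)
    have h3 : |⟪e, p' - xb⟫ - ⟪e, q' - xb⟫| ≤ dist p' q' := by
      rw [← inner_sub_right, sub_sub_sub_cancel_right, dist_eq_norm]
      exact abs_inner_unit_le hg.norm_e _
    have hprod : ⟪e, p' - xb⟫ * ⟪e, q' - xb⟫ < 0 := by
      by_contra! hge
      have h4 := mul_pos hp2 hq2
      have h5 := mul_nonpos_of_nonpos_of_nonneg hneg.le hge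
      linarith
    have h6 : |⟪e, p' - xb⟫ - ⟪e, q' - xb⟫| = |⟪e, p' - xb⟫| + |⟪e, q' - xb⟫| := by
      rcases mul_neg_iff.mp hprod with ⟨a1, a2⟩ | ⟨a1, a2⟩
      · rw [abs_of_pos a1, abs_of_neg a2, abs_of_pos (by linarith)]; ring
      · rw [abs_of_neg a1, abs_of_pos a2, abs_of_neg (by linarith)]; ring
    rw [h6] at h3
    have a1 := abs_nonneg ⟪e, p' - xb⟫
    have a2 := abs_nonneg ⟪e, q' - xb⟫
    rcases hor with h7 | h7
    · have := mul_lt_mul_of_pos_left h7 hκ; linarith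
    · have := mul_lt_mul_of_pos_left h7 hκ; linarith
  refine ⟨p, q, ⟨hmemA x hx p hp, hmemA y hy q hq, ?_⟩, mem_closedBall_iff_norm.mp hp.1,
    mem_closedBall_iff_norm.mp hq.1, by rwa [← dist_eq_norm, dist_comm]⟩
  intro p' hp' q' hq'
  by_cases hor : r / 2 < ‖p' - xb‖ ∨ r / 2 < ‖q' - xb‖
  · exact hpq.trans (hfar p' q' hp' hq' hor)
  · push Not at hor
    obtain ⟨hp1, hp2⟩ := (mem_levelComponent_iff hg h hl4 hs.value_lt hx).mp hp'
    obtain ⟨hq1, hq2⟩ := (mem_levelComponent_iff hg h hl4 hs.value_lt hy).mp hq'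
    exact hmin p' ⟨mem_closedBall_iff_norm.mpr hor.1, hp1.1, hp2.le⟩ q'
      ⟨mem_closedBall_iff_norm.mpr hor.2, hq1.1, hq2.le⟩

/-- The bisector minimizer of an aligned pair close to the saddle point exists. -/
theorem exists_isBisectorMinimizer (hg : IsGoodRadius f xb e c C ε r)
    (h : IsConeRadius f xb e c' k κ r) (hεκ : 2 * ε < κ) {p q : E n}
    (hal : IsAligned e ε xb p q) (hp : ‖p - xb‖ ≤ r / 2) (hq : ‖q - xb‖ ≤ r / 2)
    (hpq : ‖q - p‖ ≤ r / 2) :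
    ∃ z, IsBisectorMinimizer f (Metric.ball xb r) p q z := by
  have hr := hg.pos
  have hN := hal.norm_pos
  have hsub : Metric.closedBall xb (r / 2) ⊆ Metric.ball xb r :=
    Metric.closedBall_subset_ball (half_lt_self hr)
  obtain ⟨w, hw, hwn, hwf⟩ := hg.exists_crossing hal
    (hsub (mem_closedBall_iff_norm.mpr hp)) (hsub (mem_closedBall_iff_norm.mpr hq))
  have hwle : f w ≤ f xb := by
    rcases hwf with h0 | h0
    · rw [h0]
    · exact h0.le
  have hwB : w ∈ Metric.closedBall xb (r / 2) :=
    mem_closedBall_iff_norm.mpr (hwn.trans (max_le hp hq))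
  have hLc : IsCompact (Metric.closedBall xb (r / 2) ∩ AffineSubspace.perpBisector p q) :=
    (isCompact_closedBall xb (r / 2)).inter_right
      (AffineSubspace.closed_of_finiteDimensional _)
  obtain ⟨z, hz, hmin⟩ := hLc.exists_isMinOn ⟨w, hwB, hw⟩
    (hg.continuousOn.mono (Set.inter_subset_left.trans hsub))
  refine ⟨z, hz.2, hsub hz.1, fun v hv hvU => ?_⟩
  rcases le_or_gt ‖v - xb‖ (r / 2) with hvn | hvn
  · exact hmin (show v ∈ _ from ⟨mem_closedBall_iff_norm.mpr hvn, hv⟩)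
  · refine (hmin (show w ∈ _ from ⟨hwB, hw⟩) : f z ≤ f w).trans (hwle.trans ?_)
    -- A point of the bisector beyond the half ball satisfies `|⟪e, X⟫| ≤ 2 * ε * ‖X‖`, whereas a
    -- value below `f xb` would force at least `κ * ‖X‖`. This is where `2 * ε < κ` enters.
    by_contra! hlt
    have h1 := h.le_abs_inner v hvU hlt
    have h2 := hal.abs_inner_bisector_le hv
    set X := v - xb with hX
    set D := q - p with hD
    have h3 : ⟪X, D⟫ = ⟪e, X⟫ * ⟪e, D⟫ + ⟪X, perp e D⟫ := by
      conv_lhs => rw [eq_add_perp e D]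
      rw [inner_add_right, inner_smul_right, real_inner_comm e X]; ring
    have h4 : |⟪X, perp e D⟫| ≤ ‖X‖ * (ε * ‖D‖) :=
      (abs_real_inner_le_norm _ _).trans (by gcongr; exact hal.perp_le)
    have h5 : |⟪e, X⟫| * |⟪e, D⟫| ≤ ε / 2 * ‖D‖ ^ 2 + ‖X‖ * (ε * ‖D‖) := by
      rw [← abs_mul, show ⟪e, X⟫ * ⟪e, D⟫ = ⟪X, D⟫ - ⟪X, perp e D⟫ by rw [h3]; ring]
      exact (abs_sub _ _).trans (add_le_add h2 h4)
    have h6 : 3 / 4 * ‖D‖ ≤ |⟪e, D⟫| := by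
      have a1 := norm_le_abs_add_perp hg.norm_e D
      have a2 := hal.perp_le
      have a3 := mul_le_mul_of_nonneg_right hg.eps_le hN.le
      linarith
    have h7 : |⟪e, X⟫| * (3 / 4 * ‖D‖) ≤ |⟪e, X⟫| * |⟪e, D⟫| := by gcongr
    have h8 : |⟪e, X⟫| * (3 / 4) ≤ ε / 2 * ‖D‖ + ‖X‖ * ε := by
      refine le_of_mul_le_mul_right ?_ hN
      linarith
    have h9 : ε / 2 * ‖D‖ ≤ ε / 2 * ‖X‖ := by
      have := hg.eps_pos; gcongr; linarith
    have h10 : 0 < ‖X‖ := by linarith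
    have h11 := mul_lt_mul_of_pos_right hεκ h10
    linarith

/-- Near the critical level, the algorithm can proceed from a starting pair. -/
theorem exists_isStep (hg : IsGoodRadius f xb e c C ε r)
    (h : IsConeRadius f xb e c' k κ r) (hεκ : 2 * ε < κ) {x y : E n}
    (hs : IsStartingPair f (Metric.ball xb r) (f xb) x y)
    (hl : f xb - c' * (κ * r / 4) ^ 2 < f x) :
    ∃ p q z x' y', IsStep f (Metric.ball xb r) x y p q z x' y' := by
  have hκr : κ * r ≤ r := mul_le_of_le_one_left hg.pos.le h.κ_le
  obtain ⟨p, q, hcl, hp, hq, hpq⟩ := exists_isClosestPair hg h hs hl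
  have hpU := (pathComponentIn_subset hcl.left_mem).2
  have hqU := (pathComponentIn_subset hcl.right_mem).2
  have hne := IsGoodRadius.closest_ne hs hcl
  obtain ⟨hfp, hfq, hal⟩ :=
    hg.closest _ x y p q Metric.isOpen_ball hcl hne hs.value_lt hpU hqU
  obtain ⟨z, hz⟩ := exists_isBisectorMinimizer hg h hεκ hal hp hq (by linarith)
  obtain ⟨-, hxz, -, -⟩ := hg.closest_minimizer hcl hz hne hs.value_lt
  have hconv := convex_ball xb r
  obtain ⟨x', hx'⟩ := exists_isFurthestPoint
    (hg.continuousOn.mono (hconv.segment_subset hpU hz.mem)) (by rw [hfp]; exact hxz.le)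
  obtain ⟨y', hy'⟩ := exists_isFurthestPoint
    (hg.continuousOn.mono (hconv.segment_subset hqU hz.mem)) (by rw [hfq]; exact hxz.le)
  exact ⟨p, q, z, x', y', hcl, hz, hx', hy'⟩

/-- The algorithm can be carried out from starting pairs near the critical level. -/
theorem exists_isRun (hg : IsGoodRadius f xb e c C ε r)
    (h : IsConeRadius f xb e c' k κ r) (hεκ : 2 * ε < κ) {x₀ y₀ : E n}
    (hs : IsStartingPair f (Metric.ball xb r) (f xb) x₀ y₀)
    (hl : f xb - c' * (κ * r / 4) ^ 2 < f x₀) :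
    ∃ x y p q z : ℕ → E n, IsRun f (Metric.ball xb r) x₀ y₀ x y p q z := by
  -- The states of the recursion carry the lower bound on the level, which persists because each
  -- pass raises the level.
  set T : Type := {s : E n × E n //
    (IsStartingPair f (Metric.ball xb r) (f xb) s.1 s.2 ∧
      f xb - c' * (κ * r / 4) ^ 2 < f s.1) ∨ s.1 = s.2} with hT
  have hstep : ∀ s : T, ∃ (p q z : E n) (s' : T),
      (s.1.1 ≠ s.1.2 → IsStep f (Metric.ball xb r) s.1.1 s.1.2 p q z s'.1.1 s'.1.2) ∧
      (s.1.1 = s.1.2 → p = s.1.1 ∧ q = s.1.1 ∧ z = s.1.1 ∧ s'.1.1 = s.1.1 ∧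
        s'.1.2 = s.1.1) := by
    rintro ⟨⟨x, y⟩, hxy⟩
    by_cases h0 : x = y
    · exact ⟨x, x, x, ⟨(x, x), Or.inr rfl⟩, fun h1 => absurd h0 h1,
        fun _ => ⟨rfl, rfl, rfl, rfl, rfl⟩⟩
    · obtain ⟨h1, h2⟩ := hxy.resolve_right h0
      obtain ⟨p, q, z, x', y', hst⟩ := exists_isStep hg h hεκ h1 h2
      obtain ⟨h3, h4, h5⟩ := hg.step_outcome h1 hst
      refine ⟨p, q, z, ⟨(x', y'), ?_⟩, fun _ => hst, fun h6 => absurd h6 h0⟩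
      rcases h5 with h5 | h5
      · exact Or.inl ⟨h5, by rw [h4]; exact h2.trans h3⟩
      · exact Or.inr (h5.1.trans h5.2.symm)
  choose p q z next hne heq using hstep
  set S : ℕ → T := fun i => next^[i] ⟨(x₀, y₀), Or.inl ⟨hs, hl⟩⟩ with hS
  have hsucc : ∀ i, S (i + 1) = next (S i) := fun i => Function.iterate_succ_apply' next i _
  refine ⟨fun i => (S i).1.1, fun i => (S i).1.2, fun i => p (S i), fun i => q (S i),
    fun i => z (S i), rfl, rfl, ?_, ?_⟩
  · intro i hi
    simp only [hsucc]
    exact hne (S i) hi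
  · intro i hi
    simp only [hsucc]
    exact heq (S i) hi

end Existence

/-! ### Contraction and superlinear convergence -/

section Convergence

variable {n : ℕ} {f : E n → ℝ} {xb e : E n} {c C ε θ : ℝ}

namespace IsGoodRadius

/-- The distance of the closest pairs decreases by a factor of order `ε` while the algorithm stays
in a ball that is good with relative error `ε`. -/
lemma contraction (hg : IsGoodRadius f xb e c C ε θ) {δ s : ℝ}
    (hs : IsGoodRadius f xb e c C δ s) {x y p q z x' y' p' q' : E n}
    (hxy : IsStartingPair f (Metric.ball xb θ) (f xb) x y)
    (hst : IsStep f (Metric.ball xb θ) x y p q z x' y')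
    (hxy' : IsStartingPair f (Metric.ball xb θ) (f xb) x' y')
    (hcl' : IsClosestPair f (Metric.ball xb θ) x' y' p' q')
    (hp : p ∈ Metric.ball xb s) (hq : q ∈ Metric.ball xb s) (hz : z ∈ Metric.ball xb s)
    (hp' : p' ∈ Metric.ball xb s) (hq' : q' ∈ Metric.ball xb s) :
    c * ‖q' - p'‖ ^ 2 ≤ C * (2 * δ) ^ 2 * ‖q - p‖ ^ 2 := by
  -- The pair is closest in the ball of radius `θ`, but the sharper estimate of the ball of radius
  -- `s` applies because `closest` and `minimizer` allow any open `U`.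
  obtain ⟨-, -, hal⟩ := hs.closest _ x y p q Metric.isOpen_ball hst.closest
    (closest_ne hxy hst.closest) hxy.value_lt hp hq
  obtain ⟨hfp', -, hal'⟩ := hs.closest _ x' y' p' q' Metric.isOpen_ball hcl'
    (closest_ne hxy' hcl') hxy'.value_lt hp' hq'
  have h1 : ‖z - xb‖ ≤ 2 * δ * ‖q - p‖ := by
    have := hs.minimizer _ p q z (δ / 2) Metric.isOpen_ball hst.minimizer hal hz
      (hal.abs_inner_bisector_le hst.minimizer.mem_bisector)
    linarith
  obtain ⟨-, hfz, -⟩ := hg.step_outcome hxy hst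
  have h2 := hs.value_left p' q' hal' hp' 1 zero_le_one le_rfl
  have h3 := (abs_le.mp (hs.abs_sub_le z hz)).1
  have h4 : C * ‖z - xb‖ ^ 2 ≤ C * (2 * δ * ‖q - p‖) ^ 2 := by
    have := hs.C_pos; gcongr
  rw [one_smul, add_sub_cancel, hfp', hfz] at h2
  linarith

lemma norm_sub_le (hg : IsGoodRadius f xb e c C ε θ) {x y p q z x' y' : E n}
    (hxy : IsStartingPair f (Metric.ball xb θ) (f xb) x y)
    (hst : IsStep f (Metric.ball xb θ) x y p q z x' y') :
    ‖p - xb‖ ≤ ‖q - p‖ ∧ ‖q - xb‖ ≤ ‖q - p‖ ∧ ‖z - xb‖ ≤ ‖q - p‖ := by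
  have hne := closest_ne hxy hst.closest
  obtain ⟨-, -, hal⟩ := hg.closest _ x y p q Metric.isOpen_ball hst.closest hne hxy.value_lt
    (pathComponentIn_subset hst.closest.left_mem).2
    (pathComponentIn_subset hst.closest.right_mem).2
  refine ⟨(hal.left_facts hg.norm_e hg.eps_le).1, (hal.right_facts hg.norm_e hg.eps_le).1, ?_⟩
  have h1 := (hg.closest_minimizer hst.closest hst.minimizer hne hxy.value_lt).1
  have h2 := hal.norm_pos
  have h3 := hg.eps_le
  nlinarith

/-- The maximum of `f` between the points of a closest pair exists, and exceeds the critical value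
by at most a multiple of the squared distance of the pair. -/
lemma exists_isGreatest (hg : IsGoodRadius f xb e c C ε θ) {x y p q z x' y' : E n}
    (hxy : IsStartingPair f (Metric.ball xb θ) (f xb) x y)
    (hst : IsStep f (Metric.ball xb θ) x y p q z x' y') :
    ∃ M, IsGreatest (f '' segment ℝ p q) M ∧ f xb ≤ M ∧ M - f xb ≤ C * ‖q - p‖ ^ 2 := by
  have hp := (pathComponentIn_subset hst.closest.left_mem).2
  have hq := (pathComponentIn_subset hst.closest.right_mem).2
  obtain ⟨-, -, hal⟩ := hg.closest _ x y p q Metric.isOpen_ball hst.closest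
    (closest_ne hxy hst.closest) hxy.value_lt hp hq
  obtain ⟨hpn, hqn, -⟩ := hg.norm_sub_le hxy hst
  have hsub : segment ℝ p q ⊆ Metric.ball xb θ := (convex_ball xb θ).segment_subset hp hq
  have hcomp : IsCompact (segment ℝ p q) := by
    rw [segment_eq_image']
    exact isCompact_Icc.image (by fun_prop)
  obtain ⟨M, hM⟩ := (hcomp.image_of_continuousOn (hg.continuousOn.mono hsub)).exists_isGreatest
    ⟨f p, p, left_mem_segment ℝ p q, rfl⟩
  refine ⟨M, hM, ?_, ?_⟩
  · have hneg := hal.inner_mul_inner_neg hg.norm_e hg.eps_le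
    set u := ⟪e, p - xb⟫ with hu
    set v := ⟪e, q - xb⟫ with hv
    have huv : v - u ≠ 0 := by
      intro h0
      have : v = u := by linarith
      rw [this] at hneg
      exact absurd hneg (not_lt.mpr (mul_self_nonneg u))
    -- This parameter is where the segment crosses the hyperplane orthogonal to `e`.
    set t := -u / (v - u) with ht
    have ht01 : t ∈ Set.Icc (0 : ℝ) 1 := by
      rcases mul_neg_iff.mp hneg with ⟨h1, h2⟩ | ⟨h1, h2⟩
      · exact ⟨div_nonneg_of_nonpos (by linarith) (by linarith),
          by rw [ht, div_le_one_of_neg (by linarith)]; linarith⟩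
      · exact ⟨div_nonneg (by linarith) (by linarith),
          by rw [ht, div_le_one (by linarith)]; linarith⟩
    have hmem : p + t • (q - p) ∈ segment ℝ p q := by
      rw [segment_eq_image']; exact ⟨t, ht01, rfl⟩
    have hzero : ⟪e, p + t • (q - p) - xb⟫ = 0 := by
      have h1 : p + t • (q - p) - xb = (p - xb) + t • ((q - xb) - (p - xb)) := by module
      rw [h1, inner_add_right, inner_smul_right, inner_sub_right e (q - xb), ← hu, ← hv, ht,
        div_mul_cancel₀ _ huv]
      ring
    exact (hg.le_of_inner_eq_zero _ (hsub hmem) hzero).trans (hM.2 ⟨_, hmem, rfl⟩)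
  · obtain ⟨w, hw, hwM⟩ := hM.1
    have h1 : w ∈ Metric.closedBall xb ‖q - p‖ :=
      (convex_closedBall xb ‖q - p‖).segment_subset (mem_closedBall_iff_norm.mpr hpn)
        (mem_closedBall_iff_norm.mpr hqn) hw
    rw [mem_closedBall_iff_norm] at h1
    have h2 := (abs_le.mp (hg.abs_sub_le w (hsub hw))).2
    have h3 : C * ‖w - xb‖ ^ 2 ≤ C * ‖q - p‖ ^ 2 := by
      have := hg.C_pos; gcongr
    rw [← hwM]; linarith

end IsGoodRadius

lemma IsStartingPair.ne {U : Set (E n)} {d : ℝ} {x y : E n} (h : IsStartingPair f U d x y) :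
    x ≠ y := by
  rintro rfl
  exact h.not_joined (JoinedIn.refl ⟨le_refl (f x), h.left_mem⟩)

/-- All pairs of a run from a starting pair are starting pairs or equal to the saddle point. -/
lemma IsRun.invariant (hg : IsGoodRadius f xb e c C ε θ) {x₀ y₀ : E n} {x y p q z : ℕ → E n}
    (hs : IsStartingPair f (Metric.ball xb θ) (f xb) x₀ y₀)
    (hrun : IsRun f (Metric.ball xb θ) x₀ y₀ x y p q z) (i : ℕ) :
    IsStartingPair f (Metric.ball xb θ) (f xb) (x i) (y i) ∨ (x i = xb ∧ y i = xb) := by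
  induction i with
  | zero => left; rw [hrun.init_left, hrun.init_right]; exact hs
  | succ i ih =>
    rcases ih with h | h
    · exact (hg.step_outcome h (hrun.step i h.ne)).2.2
    · obtain ⟨-, -, -, h1, h2⟩ := hrun.terminated i (h.1.trans h.2.symm)
      exact Or.inr ⟨h1.trans h.1, h2.trans h.1⟩

/-- The form of `hball` serves two uses: with `s = θ` membership in the large ball suffices, and
with small `s` the norm bounds do. After termination the left side is zero. -/
lemma IsRun.sq_le (hg : IsGoodRadius f xb e c C ε θ) {x₀ y₀ : E n} {x y p q z : ℕ → E n}
    (hs : IsStartingPair f (Metric.ball xb θ) (f xb) x₀ y₀)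
    (hrun : IsRun f (Metric.ball xb θ) x₀ y₀ x y p q z) {δ s : ℝ}
    (hgs : IsGoodRadius f xb e c C δ s) {i : ℕ}
    (hball : ∀ w ∈ ({p i, q i, z i, p (i + 1), q (i + 1)} : Set (E n)), w ∈ Metric.ball xb θ →
      ‖w - xb‖ ≤ ‖q i - p i‖ ∨ ‖w - xb‖ ≤ ‖q (i + 1) - p (i + 1)‖ → w ∈ Metric.ball xb s) :
    c * ‖q (i + 1) - p (i + 1)‖ ^ 2 ≤ C * (2 * δ) ^ 2 * ‖q i - p i‖ ^ 2 := by
  rcases hrun.invariant hg hs (i + 1) with h' | h'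
  · rcases hrun.invariant hg hs i with h | h
    · have hst := hrun.step i h.ne
      have hst' := hrun.step (i + 1) h'.ne
      obtain ⟨n1, n2, n3⟩ := hg.norm_sub_le h hst
      obtain ⟨n4, n5, -⟩ := hg.norm_sub_le h' hst'
      have m1 := (pathComponentIn_subset hst.closest.left_mem).2
      have m2 := (pathComponentIn_subset hst.closest.right_mem).2
      have m4 := (pathComponentIn_subset hst'.closest.left_mem).2
      have m5 := (pathComponentIn_subset hst'.closest.right_mem).2
      exact hg.contraction hgs h hst h' hst'.closest
        (hball _ (by simp) m1 (Or.inl n1)) (hball _ (by simp) m2 (Or.inl n2))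
        (hball _ (by simp) hst.minimizer.mem (Or.inl n3)) (hball _ (by simp) m4 (Or.inr n4))
        (hball _ (by simp) m5 (Or.inr n5))
    · obtain ⟨-, -, -, h1, h2⟩ := hrun.terminated i (h.1.trans h.2.symm)
      exact absurd (h1.trans h2.symm) h'.ne
  · obtain ⟨h1, h2, -⟩ := hrun.terminated (i + 1) (h'.1.trans h'.2.symm)
    rw [h1, h2, sub_self, norm_zero]
    have := hgs.C_pos
    simp only [ne_eq, OfNat.ofNat_ne_zero, not_false_eq_true, zero_pow, mul_zero]
    positivity

/-- Along a run, the squared distances of the closest pairs converge superlinearly to zero. -/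
theorem IsRun.superlinear (hg : IsGoodRadius f xb e c C ε θ) {ε₁ : ℝ} (hε₁ : 0 < ε₁)
    (hgood : ∀ δ, 0 < δ → δ ≤ ε₁ → ∃ s : ℝ, IsGoodRadius f xb e c C δ s)
    {x₀ y₀ : E n} {x y p q z : ℕ → E n}
    (hs : IsStartingPair f (Metric.ball xb θ) (f xb) x₀ y₀)
    (hrun : IsRun f (Metric.ball xb θ) x₀ y₀ x y p q z) :
    SuperlinearToZero fun i => C * ‖q i - p i‖ ^ 2 := by
  have hc := hg.c_pos
  have hC := hg.C_pos
  set N : ℕ → ℝ := fun i => ‖q i - p i‖ ^ 2 with hN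
  have hN0 : ∀ i, 0 ≤ N i := fun i => sq_nonneg _
  set ρ := C * (2 * ε) ^ 2 / c with hρ
  have hρ0 : 0 ≤ ρ := by positivity
  have hρ1 : ρ < 1 := by rw [hρ, div_lt_one hc]; exact hg.eps_sq
  have hgeom : ∀ i, N i ≤ ρ ^ i * N 0 := fun i => le_geom hρ0 i fun k _ => by
    have := hrun.sq_le hg hs hg (i := k) fun w _ hw _ => hw
    rw [hρ, div_mul_eq_mul_div, le_div_iff₀ hc]
    linarith
  have hNlim : Tendsto N atTop (𝓝 0) := by
    refine squeeze_zero hN0 hgeom ?_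
    simpa using (tendsto_pow_atTop_nhds_zero_of_lt_one hρ0 hρ1).mul_const (N 0)
  refine ⟨by simpa using hNlim.const_mul C, ?_⟩
  rw [isLittleO_iff]
  intro d hd
  -- With this `δ` the contraction factor `C * (2 * δ) ^ 2 / c` is at most `d`; it is available once
  -- the pairs have entered the corresponding ball.
  set δ := min ε₁ (Real.sqrt (d * c / (4 * C))) with hδ
  have hδ0 : 0 < δ := lt_min hε₁ (Real.sqrt_pos.mpr (by positivity))
  have hδsq : C * (2 * δ) ^ 2 ≤ d * c := by
    have h1 : δ ^ 2 ≤ d * c / (4 * C) := by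
      rw [← Real.sq_sqrt (by positivity : 0 ≤ d * c / (4 * C))]
      have : δ ≤ Real.sqrt (d * c / (4 * C)) := min_le_right _ _
      gcongr
    rw [le_div_iff₀ (by positivity)] at h1
    linarith
  obtain ⟨s, hgs⟩ := hgood δ hδ0 (min_le_left _ _)
  have hev : ∀ᶠ i in atTop, N i < s ^ 2 :=
    hNlim.eventually (gt_mem_nhds (pow_pos hgs.pos 2))
  have hev' : ∀ᶠ i in atTop, N (i + 1) < s ^ 2 := (tendsto_add_atTop_nat 1).eventually hev
  filter_upwards [hev, hev'] with i hi hi'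
  have h1 := lt_of_pow_lt_pow_left₀ 2 hgs.pos.le hi
  have h2 := lt_of_pow_lt_pow_left₀ 2 hgs.pos.le hi'
  have h3 := hrun.sq_le hg hs hgs (i := i) fun w _ _ hw => by
    rw [mem_ball_iff_norm]
    rcases hw with hw | hw
    · exact hw.trans_lt h1
    · exact hw.trans_lt h2
  have h4 : c * N (i + 1) ≤ c * (d * N i) := by
    refine h3.trans ((mul_le_mul_of_nonneg_right hδsq (hN0 i)).trans_eq ?_)
    ring
  have h5 := le_of_mul_le_mul_left h4 hc
  change ‖C * N (i + 1)‖ ≤ d * ‖C * N i‖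
  rw [Real.norm_of_nonneg (mul_nonneg hC.le (hN0 _)),
    Real.norm_of_nonneg (mul_nonneg hC.le (hN0 _))]
  nlinarith

/-- Along a run, the maxima between the closest pairs exist and converge R-superlinearly to the
critical value from above. -/
theorem IsRun.exists_maxima (hg : IsGoodRadius f xb e c C ε θ) {ε₁ : ℝ} (hε₁ : 0 < ε₁)
    (hgood : ∀ δ, 0 < δ → δ ≤ ε₁ → ∃ s : ℝ, IsGoodRadius f xb e c C δ s)
    {x₀ y₀ : E n} {x y p q z : ℕ → E n}
    (hs : IsStartingPair f (Metric.ball xb θ) (f xb) x₀ y₀)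
    (hrun : IsRun f (Metric.ball xb θ) x₀ y₀ x y p q z) :
    ∃ M : ℕ → ℝ, (∀ i, IsGreatest (f '' segment ℝ (p i) (q i)) (M i)) ∧ (∀ i, f xb ≤ M i) ∧
      RSuperlinearToZero (fun i => M i - f xb) := by
  have key : ∀ i, ∃ M, IsGreatest (f '' segment ℝ (p i) (q i)) M ∧ f xb ≤ M ∧
      M - f xb ≤ C * ‖q i - p i‖ ^ 2 := by
    intro i
    rcases hrun.invariant hg hs i with h | h
    · exact hg.exists_isGreatest h (hrun.step i h.ne)
    · obtain ⟨h1, h2, -⟩ := hrun.terminated i (h.1.trans h.2.symm)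
      rw [h1, h2, h.1]
      exact ⟨f xb, by simp, le_rfl, by simp⟩
  choose M hM hle hup using key
  refine ⟨M, hM, hle, fun i => C * ‖q i - p i‖ ^ 2, hrun.superlinear hg hε₁ hgood hs, fun i => ?_⟩
  rw [abs_of_nonneg (sub_nonneg.mpr (hle i))]
  exact hup i

end Convergence

end MountainPass

theorem mainTheorem6 (n : ℕ) (f : MountainPass.E n → ℝ) (xbar : MountainPass.E n)
    (V : Set (MountainPass.E n)) (hV : IsOpen V) (hxV : xbar ∈ V) (hf : ContDiffOn ℝ 2 f V)
    (hx : MountainPass.IsNondegenerateCriticalPointOfIndexOne f xbar) :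
    ∃ θ₀ : ℝ, 0 < θ₀ ∧ ∀ θ : ℝ, 0 < θ → θ ≤ θ₀ →
      (∀ x₀ y₀ : MountainPass.E n,
        MountainPass.IsStartingPair f (Metric.ball xbar θ) (f xbar) x₀ y₀ →
        ∀ x y p q z : ℕ → MountainPass.E n,
          MountainPass.IsRun f (Metric.ball xbar θ) x₀ y₀ x y p q z →
          ∃ M : ℕ → ℝ, (∀ i, IsGreatest (f '' segment ℝ (p i) (q i)) (M i)) ∧
            (∀ i, f xbar ≤ M i) ∧
            MountainPass.RSuperlinearToZero (fun i => M i - f xbar)) ∧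
      (∃ ε₀ : ℝ, 0 < ε₀ ∧ ∀ x₀ y₀ : MountainPass.E n,
        MountainPass.IsStartingPair f (Metric.ball xbar θ) (f xbar) x₀ y₀ →
        f xbar - ε₀ < f x₀ →
        ∃ x y p q z : ℕ → MountainPass.E n,
          MountainPass.IsRun f (Metric.ball xbar θ) x₀ y₀ x y p q z) := by
  have hfx : ContDiffAt ℝ 2 f xbar := hf.contDiffAt (hV.mem_nhds hxV)
  obtain ⟨e, a, b, hsad⟩ := hx.exists_isSaddleForm hfx
  obtain ⟨c, C, ε₁, -, -, hε₁, hgood⟩ :=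
    MountainPass.exists_isGoodRadius hfx hx.critical hsad
  obtain ⟨c', k, κ, r₂, hr₂, hcone⟩ :=
    MountainPass.exists_isConeRadius hfx hx.critical hsad
  have hκ := hcone.κ_pos
  have hc' := hcone.c_pos
  -- The cone constant `κ` is fixed before the alignment error, so that `2 * ε < κ` can be arranged.
  obtain ⟨r₁, hr₁⟩ := hgood (min ε₁ (κ / 3)) (by positivity) (min_le_left _ _)
  have hεκ : 2 * min ε₁ (κ / 3) < κ := by
    have : min ε₁ (κ / 3) ≤ κ / 3 := min_le_right _ _
    linarith
  refine ⟨min r₁ r₂, lt_min hr₁.pos hr₂, fun θ hθ hθ₀ => ?_⟩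
  have hg := hr₁.mono hθ (hθ₀.trans (min_le_left _ _))
  have hcn := hcone.mono (hθ₀.trans (min_le_right _ _))
  refine ⟨fun x₀ y₀ hs x y p q z hrun => hrun.exists_maxima hg hε₁ hgood hs,
    c' * (κ * θ / 4) ^ 2, by positivity, fun x₀ y₀ hs hl => ?_⟩
  exact MountainPass.exists_isRun hg hcn hεκ hs hl
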